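/- Let $K$ be an algebraically closed field of characteristic different from $2$ and $3$, and let $\omega\in K$ be a primitive cube root of unity. Let $\mathrm{G}_{32}\subset \mathbf{GL}_4(K)$ be the complex reflection group generated by $$\mu=-\omega\begin{pmatrix}1&0&0&0\\0&-1&0&0\\0&0&0&-1\\0&0&-1&0\end{pmatrix},\qquad \nu=\frac{1}{\omega-\omega^2}\begin{pmatrix}0&1&1&1\\0&1&-\omega-1&\omega\\0&-1&-\omega&\omega+1\\-2\omega-1&0&0&0\end{pmatrix},$$ acting on $K^4$ with coordinates $c_1,\dots,c_4$. Let "Family 6" $\subset\mathbf{P}^3$ be the set of points that are the lines in $K^4$ in the $\mathrm{G}_{32}$-orbit of the flat $c_2=c_3=c_4=0$, i.e. the $\mathrm{G}_{32}$-orbit of $[1:0:0:0]$. Consider the five coefficients of the Coble cubic, $$\gamma_1=3c_1c_2c_3c_4,\quad \gamma_2=-c_1(c_2^3+c_3^3+c_4^3),\quad \gamma_3=c_2(c_1^3+c_3^3-c_4^3),$$ $$\gamma_4=c_3(c_1^3-c_2^3+c_4^3),\quad \gamma_5=c_4(c_1^3+c_2^3-c_3^3),$$ and the Burkhardt quartic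 $\mathcal{B}\subset\mathbf{P}^4$ defined by $$\gamma_1(\gamma_1^3+\gamma_2^3+\gamma_3^3+\gamma_4^3+\gamma_5^3)+3\gamma_2\gamma_3\gamma_4\gamma_5=0.$$ The group $\mathrm{G}_{32}$ acts linearly on $K^5$ by the unique representation $\rho$ such that $\gamma(g\,c)=\rho(g)\,\gamma(c)$ for all $g\in\mathrm{G}_{32}$ and $c\in K^4$, and hence it acts on $\mathbf{P}^4$. Then the base locus of the rational map $\gamma=[\gamma_1:\dots:\gamma_5]\colon\mathbf{P}^3\dashrightarrow\mathbf{P}^4$ (the set of common zeros of the $\gamma_i$) is exactly Family 6. The $\mathrm{G}_{32}$-orbit of $[0:0:0:0:1]$ is contained in $\mathcal{B}$ and consists of exactly $160$ points, and the image of $\gamma\colon\mathbf{P}^3\setminus\text{Family 6}\to\mathbf{P}^4$ is exactly the complement in $\mathcal{B}$ of this orbit. -/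

import Mathlib

open scoped LinearAlgebra.Projectivization

namespace Burkhardt

variable {K : Type*} [Field K]

/-- The five coefficients `γ₁, …, γ₅` of the Coble cubic, as functions of `c = (c₁, c₂, c₃, c₄)`. -/
def gamma (c : Fin 4 → K) : Fin 5 → K :=
  ![3 * c 0 * c 1 * c 2 * c 3,
    -c 0 * (c 1 ^ 3 + c 2 ^ 3 + c 3 ^ 3),
    c 1 * (c 0 ^ 3 + c 2 ^ 3 - c 3 ^ 3),
    c 2 * (c 0 ^ 3 - c 1 ^ 3 + c 3 ^ 3),
    c 3 * (c 0 ^ 3 + c 1 ^ 3 - c 2 ^ 3)]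

/-- The quartic form that defines the Burkhardt quartic. -/
def quarticForm (v : Fin 5 → K) : K :=
  v 0 * (v 0 ^ 3 + v 1 ^ 3 + v 2 ^ 3 + v 3 ^ 3 + v 4 ^ 3) + 3 * v 1 * v 2 * v 3 * v 4

theorem gamma_smul (a : K) (c : Fin 4 → K) : gamma (a • c) = a ^ 4 • gamma c := by
  ext i
  fin_cases i <;> simp [gamma] <;> ring

theorem quarticForm_smul (a : K) (v : Fin 5 → K) :
    quarticForm (a • v) = a ^ 4 * quarticForm v := by
  simp [quarticForm]
  ring

variable (K) in
/-- The Burkhardt quartic, as a set of points of `ℙ⁴`. -/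
def quartic : Set (ℙ K (Fin 5 → K)) := {q | quarticForm q.rep = 0}

theorem mk_mem_quartic {v : Fin 5 → K} (hv : v ≠ 0) :
    Projectivization.mk K v hv ∈ quartic K ↔ quarticForm v = 0 := by
  obtain ⟨a, ha⟩ := Projectivization.exists_smul_eq_mk_rep K v hv
  rw [quartic, Set.mem_ofPred_eq, ← ha, Units.smul_def, quarticForm_smul]
  simp

variable (K) in
/-- The base locus of `γ : ℙ³ ⇢ ℙ⁴`: the common zeros of `γ₁, …, γ₅`. -/
def baseLocus : Set (ℙ K (Fin 4 → K)) := {p | gamma p.rep = 0}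

theorem mk_mem_baseLocus {c : Fin 4 → K} (hc : c ≠ 0) :
    Projectivization.mk K c hc ∈ baseLocus K ↔ gamma c = 0 := by
  obtain ⟨a, ha⟩ := Projectivization.exists_smul_eq_mk_rep K c hc
  rw [baseLocus, Set.mem_ofPred_eq, ← ha, Units.smul_def, gamma_smul]
  simp

/-- The rational map `γ : ℙ³ ⇢ ℙ⁴`, `[c] ↦ [γ₁(c) : … : γ₅(c)]`, on its domain of definition. -/
noncomputable def gammaMap (p : ((baseLocus K)ᶜ : Set (ℙ K (Fin 4 → K)))) :
    ℙ K (Fin 5 → K) :=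
  Projectivization.mk K (gamma p.1.rep) p.2

theorem gammaMap_mk {c : Fin 4 → K} (hc : c ≠ 0)
    (h : Projectivization.mk K c hc ∈ (baseLocus K)ᶜ) :
    gammaMap ⟨Projectivization.mk K c hc, h⟩ =
      Projectivization.mk K (gamma c) (fun h0 => h ((mk_mem_baseLocus hc).2 h0)) := by
  obtain ⟨a, ha⟩ := Projectivization.exists_smul_eq_mk_rep K c hc
  refine (Projectivization.mk_eq_mk_iff K _ _ _ _).2 ⟨a ^ 4, ?_⟩
  simp only [← ha, Units.smul_def, gamma_smul, Units.val_pow_eq_pow_val]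

/-- First generator `μ` of the reflection group `G₃₂`. -/
def mu (ω : K) : Matrix (Fin 4) (Fin 4) K :=
  (-ω) • !![1, 0, 0, 0;
            0, -1, 0, 0;
            0, 0, 0, -1;
            0, 0, -1, 0]

/-- Second generator `ν` of the reflection group `G₃₂`. -/
def nu (ω : K) : Matrix (Fin 4) (Fin 4) K :=
  (1 / (ω - ω ^ 2)) • !![0, 1, 1, 1;
                        0, 1, -ω - 1, ω;
                        0, -1, -ω, ω + 1;
                        -2 * ω - 1, 0, 0, 0]

section generators

variable {ω : K}

theorem omega_rel (hω : IsPrimitiveRoot ω 3) : ω ^ 2 = -ω - 1 := by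
  have h1 : ω - 1 ≠ 0 := sub_ne_zero.2 (hω.ne_one (by norm_num))
  have h3 := hω.pow_eq_one
  have : (ω - 1) * (ω ^ 2 + ω + 1) = 0 := by linear_combination h3
  rcases mul_eq_zero.1 this with h | h
  · exact absurd h h1
  · linear_combination h

theorem sub_sq_mul (hω : IsPrimitiveRoot ω 3) : (ω - ω ^ 2) * (ω - ω ^ 2) = -3 := by
  have h := omega_rel hω
  grind

theorem sub_ne_zero' (h3 : (3 : K) ≠ 0) (hω : IsPrimitiveRoot ω 3) : ω - ω ^ 2 ≠ 0 := by
  intro h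
  have := sub_sq_mul hω
  rw [h] at this
  exact h3 (by linear_combination this)

theorem isUnit_mu (hω : IsPrimitiveRoot ω 3) : IsUnit (mu ω) := by
  have h0 : ω ≠ 0 := hω.ne_zero (by norm_num)
  rw [Matrix.isUnit_iff_isUnit_det, isUnit_iff_ne_zero, mu, Matrix.det_smul]
  simp [Matrix.det_succ_row_zero, Fin.sum_univ_succ, Fin.succAbove, h0]

theorem isUnit_nu (h3 : (3 : K) ≠ 0) (hω : IsPrimitiveRoot ω 3) : IsUnit (nu ω) := by
  have h0 := sub_ne_zero' h3 hω
  have h1 := omega_rel hω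
  have hd : (!![0, 1, 1, 1; 0, 1, -ω - 1, ω; 0, -1, -ω, ω + 1; -2 * ω - 1, 0, 0, 0] :
      Matrix (Fin 4) (Fin 4) K).det = 9 := by
    simp [Matrix.det_succ_row_zero, Fin.sum_univ_succ, Fin.succAbove]
    grind
  rw [Matrix.isUnit_iff_isUnit_det, isUnit_iff_ne_zero, nu, Matrix.det_smul, hd]
  have : (9 : K) ≠ 0 := by
    have := mul_ne_zero h3 h3
    norm_num at this ⊢
    exact this
  simp [h0, this]

end generators

/-- The complex reflection group `G₃₂`, generated by `μ` and `ν` in `GL₄(K)`. -/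
def G32 (ω : K) : Subgroup (GL (Fin 4) K) :=
  Subgroup.closure {g | (g : Matrix (Fin 4) (Fin 4) K) = mu ω ∨
    (g : Matrix (Fin 4) (Fin 4) K) = nu ω}

/-- The union of the flats in the `G₃₂`-orbit of the flat `c₂ = c₃ = c₄ = 0`, as a set of points
of `ℙ³`: each of these flats is a line in `K⁴`, i.e. one point of `ℙ³`. -/
def family6 (ω : K) : Set (ℙ K (Fin 4 → K)) :=
  MulAction.orbit (G32 ω) (Projectivization.mk K ![1, 0, 0, 0] (by simp))

/-- The functions `γ₁, …, γ₅` are linearly independent. -/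
theorem gamma_linearIndependent (h2 : (2 : K) ≠ 0) (h3 : (3 : K) ≠ 0) {x : Fin 5 → K}
    (h : ∀ c : Fin 4 → K, x ⬝ᵥ gamma c = 0) : x = 0 := by
  have e1 := h ![1, 1, 0, 0]
  have e2 := h ![1, 0, 1, 0]
  have e3 := h ![1, 0, 0, 1]
  have e4 := h ![0, 1, 2, 0]
  have e5 := h ![1, 1, 1, 1]
  simp [dotProduct, gamma, Fin.sum_univ_succ] at e1 e2 e3 e4 e5
  have h1 : x 1 = 0 := by
    have : (2 : K) * 3 * x 1 = 0 := by
      grind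
    simpa [h2, h3] using this
  have h2' : x 2 = 0 := by grind
  have h3' : x 3 = 0 := by grind
  have h4' : x 4 = 0 := by grind
  have h0 : x 0 = 0 := by
    have : (3 : K) * x 0 = 0 := by grind
    simpa [h3] using this
  ext i
  fin_cases i <;> simpa

theorem matrix_ext_of_gamma (h2 : (2 : K) ≠ 0) (h3 : (3 : K) ≠ 0)
    {M N : Matrix (Fin 5) (Fin 5) K}
    (h : ∀ c : Fin 4 → K, M.mulVec (gamma c) = N.mulVec (gamma c)) :
    M = N := by
  ext i j
  have : M i - N i = 0 := gamma_linearIndependent h2 h3 fun c => by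
    rw [sub_dotProduct, sub_eq_zero]
    exact congrFun (h c) i
  exact sub_eq_zero.1 (congrFun this j)

theorem exists_GL_of_matrix (h2 : (2 : K) ≠ 0) (h3 : (3 : K) ≠ 0) (g : GL (Fin 4) K)
    (M : Matrix (Fin 5) (Fin 5) K) (h : ∀ c : Fin 4 → K, gamma (g • c) = M.mulVec (gamma c)) :
    ∃ M' : GL (Fin 5) K, ∀ c : Fin 4 → K, gamma (g • c) = M' • gamma c := by
  have hM : IsUnit M := by
    rw [Matrix.isUnit_iff_isUnit_det, isUnit_iff_ne_zero]
    intro h0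
    obtain ⟨v, hv, hv0⟩ := Matrix.exists_vecMul_eq_zero_iff.2 h0
    refine hv (gamma_linearIndependent h2 h3 fun c => ?_)
    have := h (g⁻¹ • c)
    rw [smul_inv_smul] at this
    rw [this, Matrix.dotProduct_mulVec, hv0, zero_dotProduct]
  obtain ⟨u, rfl⟩ := hM
  exact ⟨u, h⟩

theorem gamma_mu {ω : K} (hω : IsPrimitiveRoot ω 3) (c : Fin 4 → K) :
    gamma ((mu ω).mulVec c) = ((-ω) • !![1, 0, 0, 0, 0;
                                         0, 1, 0, 0, 0;
                                         0, 0, 1, 0, 0;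
                                         0, 0, 0, 0, 1;
                                         0, 0, 0, 1, 0] : Matrix _ _ K).mulVec (gamma c) := by
  have h := hω.pow_eq_one
  ext i
  fin_cases i <;> simp [gamma, mu, Matrix.mulVec, dotProduct, Fin.sum_univ_succ] <;> grind

theorem gamma_nu {ω : K} (h3 : (3 : K) ≠ 0) (hω : IsPrimitiveRoot ω 3) (c : Fin 4 → K) :
    gamma ((nu ω).mulVec c) =
      ((1 / (ω - ω ^ 2)) • !![1, 1, 0, 0, 0;
                              0, 0, 1, 1, 1;
                              0, 0, 1, ω ^ 2, ω;
                              0, 0, 1, ω, ω ^ 2;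
                              2, -1, 0, 0, 0] : Matrix _ _ K).mulVec (gamma c) := by
  have h := omega_rel hω
  have h0 := sub_ne_zero' h3 hω
  have hs := sub_sq_mul hω
  have key : ∀ x y : K, (∃ z, x = z ∧ z = (ω - ω ^ 2) ^ 3 * y) →
      (1 / (ω - ω ^ 2)) ^ 4 * x = 1 / (ω - ω ^ 2) * y := by
    rintro x y ⟨z, rfl, rfl⟩
    field_simp
  rw [nu, Matrix.smul_mulVec, gamma_smul, Matrix.smul_mulVec]
  ext i
  rw [Pi.smul_apply, Pi.smul_apply, smul_eq_mul, smul_eq_mul]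
  apply key
  refine ⟨_, rfl, ?_⟩
  have h3' : (ω - ω ^ 2) ^ 3 = -3 * (2 * ω + 1) := by
    rw [pow_succ, sq, hs, h]; ring
  rw [h3']
  fin_cases i <;> simp [gamma, Matrix.mulVec, dotProduct, Fin.sum_univ_succ] <;> grind

/-- Every `g ∈ G₃₂` acts on the functions `γ₁, …, γ₅` through a linear map. -/
theorem exists_rep {ω : K} (h2 : (2 : K) ≠ 0) (h3 : (3 : K) ≠ 0) (hω : IsPrimitiveRoot ω 3)
    (g : G32 ω) :
    ∃ M : GL (Fin 5) K, ∀ c : Fin 4 → K, gamma ((g : GL (Fin 4) K) • c) = M • gamma c := by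
  obtain ⟨g, hg⟩ := g
  change ∃ M : GL (Fin 5) K, ∀ c : Fin 4 → K, gamma (g • c) = M • gamma c
  induction hg using Subgroup.closure_induction with
  | mem x hx =>
    rcases hx with hx | hx
    · refine exists_GL_of_matrix h2 h3 x _ fun c => Eq.trans ?_ (gamma_mu hω c)
      rw [← hx]
      rfl
    · refine exists_GL_of_matrix h2 h3 x _ fun c => Eq.trans ?_ (gamma_nu h3 hω c)
      rw [← hx]
      rfl
  | one => exact ⟨1, fun c => by simp⟩
  | mul x y _ _ hx hy =>
    obtain ⟨M, hM⟩ := hx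
    obtain ⟨N, hN⟩ := hy
    exact ⟨M * N, fun c => by rw [mul_smul, hM, hN, mul_smul]⟩
  | inv x _ hx =>
    obtain ⟨M, hM⟩ := hx
    exact ⟨M⁻¹, fun c => by rw [eq_inv_smul_iff, ← hM, smul_inv_smul]⟩

/-- The representation of `G₃₂` afforded by `γ₁, …, γ₅`: `ρ(g)` is the matrix with
`γ(g c) = ρ(g) γ(c)` for all `c`. -/
noncomputable def rho {ω : K} (h2 : (2 : K) ≠ 0) (h3 : (3 : K) ≠ 0) (hω : IsPrimitiveRoot ω 3) :
    G32 ω →* GL (Fin 5) K :=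
  MonoidHom.mk' (fun g => (exists_rep h2 h3 hω g).choose) fun g g' => Units.ext <|
    matrix_ext_of_gamma h2 h3 fun c => by
      have e := (exists_rep h2 h3 hω (g * g')).choose_spec c
      have e' : gamma (((g * g' : G32 ω) : GL (Fin 4) K) • c) =
          ((exists_rep h2 h3 hω g).choose * (exists_rep h2 h3 hω g').choose) • gamma c := by
        rw [Subgroup.coe_mul, mul_smul, (exists_rep h2 h3 hω g).choose_spec,
          (exists_rep h2 h3 hω g').choose_spec, ← mul_smul]
      exact e.symm.trans e'

theorem rho_spec {ω : K} (h2 : (2 : K) ≠ 0) (h3 : (3 : K) ≠ 0) (hω : IsPrimitiveRoot ω 3)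
    (g : G32 ω) (c : Fin 4 → K) :
    gamma ((g : GL (Fin 4) K) • c) = rho h2 h3 hω g • gamma c :=
  (exists_rep h2 h3 hω g).choose_spec c

theorem rho_unique {ω : K} (h2 : (2 : K) ≠ 0) (h3 : (3 : K) ≠ 0) (hω : IsPrimitiveRoot ω 3)
    (g : G32 ω) (M : GL (Fin 5) K)
    (h : ∀ c : Fin 4 → K, gamma ((g : GL (Fin 4) K) • c) = M • gamma c) :
    M = rho h2 h3 hω g :=
  Units.ext <| matrix_ext_of_gamma h2 h3 fun c => by
    have := (h c).symm.trans (rho_spec h2 h3 hω g c)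
    exact this

variable (K) in
/-- The point `[0 : 0 : 0 : 0 : 1]` of `ℙ⁴`. -/
def lastPoint : ℙ K (Fin 5 → K) :=
  Projectivization.mk K ![0, 0, 0, 0, 1] (by simp)

/-- The `G₃₂`-orbit of `[0 : 0 : 0 : 0 : 1]` in `ℙ⁴`. -/
def missingOrbit {ω : K} (h2 : (2 : K) ≠ 0) (h3 : (3 : K) ≠ 0) (hω : IsPrimitiveRoot ω 3) :
    Set (ℙ K (Fin 5 → K)) :=
  Set.range fun g : G32 ω => rho h2 h3 hω g • lastPoint K

end Burkhardt

/-!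
The five quartics `γᵢ` are, up to sign, the `4 × 4` Pfaffians of an alternating `5 × 5` matrix
`skew c` of quadratic forms in `c`. A pair `(c, q)` is called incident if `skew c` kills `q`. If
`γ(c) ≠ 0`, the matrix has rank four and its kernel is spanned by `γ(c)` (`Incident.exists_smul`).
The matrix is equivariant under `G₃₂` up to scalars (`exists_skew_smul`), so incidence is
`G₃₂`-invariant, and so is the quartic.

Every point `q` of the quartic is incident to some `c` (`exists_incident`). For fixed `q`,
incidence is given by quadrics in `c`. At a point of the quartic outside the hyperplane `q 0 = 0`
where one of the partial derivatives in the other coordinates does not vanish, linear syzygies of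
these quadrics reduce the system to one quadric together with the condition that a `2 × 3` matrix
of linear forms has rank at most one. Such a system is solvable over an algebraically closed
field, since it amounts to finding a zero of a binary sextic (`exists_pencil_zero`). The other
points have explicit solutions.

Consequently a point of the quartic that `γ` misses is incident only to base points of `γ`.
Suitable products of conjugates of `μ` are monomial, and with them each base point can be moved to
`[1 : 0 : 0 : 0]` or to `[0 : 1 : 1 : 1]` (`gamma_eq_zero_induction`). The element `ν` carries
the second of these to the first, so the base locus is a single orbit. The points incident to `[1 : 0 : 0 : 0]` form the
plane `q 0 = q 1 = 0`, where the missed points can be determined by hand (`IsMissed.of_plane`):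
they are three coordinate points and nine others. Transporting these by the group gives an
explicit list of special vectors that contains all missed points (`IsMissed.isSpecial`). All the
special vectors lie in the orbit of `[0 : 0 : 0 : 0 : 1]` (`InOrbit.of_isSpecial`), and that point
is missed (`isMissed_last`). Hence being missed, being special and lying in the orbit are
equivalent, which identifies the complement of the image, and counting the special vectors up to
scalars gives `4 * (1 + 9 + 3 + 27) = 160`.
-/

namespace Burkhardt

variable {K : Type*} [Field K]

/-! ### The alternating matrix with Pfaffians `γ` -/

/-- An alternating matrix of quadratic forms with kernel `γ(c)`: up to sign, `γ₁(c), …, γ₅(c)` are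
its `4 × 4` Pfaffians, so for `γ(c) ≠ 0` the kernel is the line spanned by `γ(c)`. -/
def skew (c : Fin 4 → K) : Matrix (Fin 5) (Fin 5) K :=
  !![0, c 0 ^ 2, c 1 ^ 2, c 2 ^ 2, c 3 ^ 2;
     -c 0 ^ 2, 0, c 2 * c 3, c 1 * c 3, c 1 * c 2;
     -c 1 ^ 2, -(c 2 * c 3), 0, -(c 0 * c 3), c 0 * c 2;
     -c 2 ^ 2, -(c 1 * c 3), c 0 * c 3, 0, -(c 0 * c 1);
     -c 3 ^ 2, -(c 1 * c 2), -(c 0 * c 2), c 0 * c 1, 0]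

theorem skew_smul (a : K) (c : Fin 4 → K) : skew (a • c) = a ^ 2 • skew c := by
  ext i j
  fin_cases i <;> fin_cases j <;> simp [skew] <;> ring

/-- The vector `q` lies in the kernel of `skew c`. For `γ(c) ≠ 0` this says that `q` is a multiple
of `γ(c)`; the condition still makes sense, and defines a plane in `ℙ⁴`, at a base point `c`. -/
def Incident (c : Fin 4 → K) (q : Fin 5 → K) : Prop := (skew c).mulVec q = 0

theorem incident_iff (c : Fin 4 → K) (q : Fin 5 → K) : Incident c q ↔
    c 0 ^ 2 * q 1 + c 1 ^ 2 * q 2 + c 2 ^ 2 * q 3 + c 3 ^ 2 * q 4 = 0 ∧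
    c 0 ^ 2 * q 0 = c 2 * c 3 * q 2 + c 1 * c 3 * q 3 + c 1 * c 2 * q 4 ∧
    c 1 ^ 2 * q 0 = -(c 2 * c 3 * q 1) - c 0 * c 3 * q 3 + c 0 * c 2 * q 4 ∧
    c 2 ^ 2 * q 0 = -(c 1 * c 3 * q 1) + c 0 * c 3 * q 2 - c 0 * c 1 * q 4 ∧
    c 3 ^ 2 * q 0 = -(c 1 * c 2 * q 1) - c 0 * c 2 * q 2 + c 0 * c 1 * q 3 := by
  simp only [Incident, funext_iff, Fin.forall_fin_succ, Matrix.mulVec, dotProduct, skew,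
    Fin.sum_univ_succ]
  simp
  refine and_congr ⟨?_, ?_⟩ (and_congr ⟨?_, ?_⟩ (and_congr ⟨?_, ?_⟩
    (and_congr ⟨?_, ?_⟩ ⟨?_, ?_⟩))) <;> intro h <;>
    first | linear_combination h | linear_combination -h

/-- A vector killed by an alternating `5 × 5` matrix is proportional to the vector of `4 × 4`
Pfaffians. -/
theorem Incident.mul_gamma_eq {c : Fin 4 → K} {q : Fin 5 → K} (h : Incident c q) (i j : Fin 5) :
    gamma c i * q j = gamma c j * q i := by
  obtain ⟨h0, h1, h2, h3, h4⟩ := (incident_iff c q).1 h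
  fin_cases i <;> fin_cases j <;> simp [gamma] <;> grind

theorem Incident.exists_smul {c : Fin 4 → K} {q : Fin 5 → K} (h : Incident c q)
    (hq : q ≠ 0) (hc : gamma c ≠ 0) : ∃ a : K, a ≠ 0 ∧ gamma c = a • q := by
  obtain ⟨i, hi⟩ := Function.ne_iff.1 hq
  have hi : q i ≠ 0 := hi
  have e : gamma c = (gamma c i / q i) • q := by
    ext j
    have := h.mul_gamma_eq i j
    simp only [Pi.smul_apply, smul_eq_mul]
    field_simp
    exact this.symm
  refine ⟨_, fun h0 => hc ?_, e⟩
  rw [e, h0, zero_smul]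

set_option maxHeartbeats 1000000 in
/-- The form `skew c` is equivariant, up to a scalar, under the generator `μ`; the matrix on the
left is `ρ(μ)` without its factor `-ω`. -/
theorem skew_mu (ω : K) (c : Fin 4 → K) :
    (!![1, 0, 0, 0, 0; 0, 1, 0, 0, 0; 0, 0, 1, 0, 0; 0, 0, 0, 0, 1; 0, 0, 0, 1, 0] :
      Matrix (Fin 5) (Fin 5) K).transpose * skew ((mu ω).mulVec c) *
      !![1, 0, 0, 0, 0; 0, 1, 0, 0, 0; 0, 0, 1, 0, 0; 0, 0, 0, 0, 1; 0, 0, 0, 1, 0] =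
      ω ^ 2 • skew c := by
  have e : (mu ω).mulVec c = (-ω) • ![c 0, -c 1, -c 3, -c 2] := by
    ext i; fin_cases i <;> simp [mu, Matrix.mulVec, dotProduct, Fin.sum_univ_succ]
  rw [e, skew_smul, Matrix.mul_smul, Matrix.smul_mul, neg_sq]
  refine congrArg (ω ^ 2 • ·) ?_
  ext i j
  fin_cases i <;> fin_cases j <;> simp [skew, Matrix.mul_apply, Fin.sum_univ_succ] <;> ring

set_option maxHeartbeats 1000000 in
/-- The form `skew c` is equivariant, up to a scalar, under the generator `ν`; the matrix on the
left is `ρ(ν)` without its factor `1 / (ω - ω ^ 2)`. -/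
theorem skew_nu {ω : K} (hω : IsPrimitiveRoot ω 3) (c : Fin 4 → K) :
    (!![1, 1, 0, 0, 0; 0, 0, 1, 1, 1; 0, 0, 1, ω ^ 2, ω; 0, 0, 1, ω, ω ^ 2; 2, -1, 0, 0, 0] :
      Matrix (Fin 5) (Fin 5) K).transpose * skew ((nu ω).mulVec c) *
      !![1, 1, 0, 0, 0; 0, 0, 1, 1, 1; 0, 0, 1, ω ^ 2, ω; 0, 0, 1, ω, ω ^ 2; 2, -1, 0, 0, 0] =
      (9 * (1 / (ω - ω ^ 2)) ^ 2) • skew c := by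
  have h := omega_rel hω
  rw [nu, Matrix.smul_mulVec, skew_smul, Matrix.mul_smul, Matrix.smul_mul, mul_comm (9 : K),
    mul_smul]
  refine congrArg ((1 / (ω - ω ^ 2)) ^ 2 • ·) ?_
  ext i j
  fin_cases i <;> fin_cases j <;>
    simp [skew, Matrix.mul_apply, Matrix.mulVec, dotProduct, Fin.sum_univ_succ] <;> grind

/-! ### Invariance of incidence and of the quartic under `G₃₂` -/

section
variable {ω : K} (h2 : (2 : K) ≠ 0) (h3 : (3 : K) ≠ 0) (hω : IsPrimitiveRoot ω 3)

theorem rho_eq_of_gamma (g : G32 ω) (M : Matrix (Fin 5) (Fin 5) K)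
    (h : ∀ c : Fin 4 → K, gamma ((g : GL (Fin 4) K) • c) = M.mulVec (gamma c)) :
    (rho h2 h3 hω g : Matrix (Fin 5) (Fin 5) K) = M :=
  matrix_ext_of_gamma h2 h3 fun c => (rho_spec h2 h3 hω g c).symm.trans (h c)

theorem rho_mu {x : GL (Fin 4) K} (hg : x ∈ G32 ω) (hx : (x : Matrix (Fin 4) (Fin 4) K) = mu ω) :
    (rho h2 h3 hω ⟨x, hg⟩ : Matrix (Fin 5) (Fin 5) K) =
      (-ω) • !![1, 0, 0, 0, 0; 0, 1, 0, 0, 0; 0, 0, 1, 0, 0; 0, 0, 0, 0, 1; 0, 0, 0, 1, 0] := by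
  refine rho_eq_of_gamma h2 h3 hω _ _ fun c => Eq.trans ?_ (gamma_mu hω c)
  change gamma ((x : Matrix (Fin 4) (Fin 4) K).mulVec c) = _
  rw [hx]

theorem rho_nu {x : GL (Fin 4) K} (hg : x ∈ G32 ω) (hx : (x : Matrix (Fin 4) (Fin 4) K) = nu ω) :
    (rho h2 h3 hω ⟨x, hg⟩ : Matrix (Fin 5) (Fin 5) K) =
      (1 / (ω - ω ^ 2)) • !![1, 1, 0, 0, 0; 0, 0, 1, 1, 1; 0, 0, 1, ω ^ 2, ω; 0, 0, 1, ω, ω ^ 2;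
        2, -1, 0, 0, 0] := by
  refine rho_eq_of_gamma h2 h3 hω _ _ fun c => Eq.trans ?_ (gamma_nu h3 hω c)
  change gamma ((x : Matrix (Fin 4) (Fin 4) K).mulVec c) = _
  rw [hx]

/-- Incidence is invariant under `G₃₂` because the family of alternating forms `skew c` is, up to
scalars. -/
theorem exists_skew_smul (g : G32 ω) : ∃ k : K, k ≠ 0 ∧ ∀ c : Fin 4 → K,
    (rho h2 h3 hω g : Matrix (Fin 5) (Fin 5) K).transpose * skew ((g : GL (Fin 4) K) • c) *
      (rho h2 h3 hω g : Matrix (Fin 5) (Fin 5) K) = k • skew c := by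
  obtain ⟨g, hg⟩ := g
  have hs := sub_ne_zero' h3 hω
  have h0 : ω ≠ 0 := hω.ne_zero (by norm_num)
  induction hg using Subgroup.closure_induction with
  | mem x hx =>
    rcases hx with hx | hx
    · generalize_proofs hg
      simp only [rho_mu h2 h3 hω hg hx]
      refine ⟨ω ^ 4, pow_ne_zero _ h0, fun c => ?_⟩
      have e : x • c = (mu ω).mulVec c := by rw [← hx]; rfl
      rw [e, Matrix.transpose_smul, Matrix.smul_mul, Matrix.smul_mul, Matrix.mul_smul, skew_mu,
        smul_smul, smul_smul]
      ring_nf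
    · generalize_proofs hg
      simp only [rho_nu h2 h3 hω hg hx]
      refine ⟨(1 / (ω - ω ^ 2)) ^ 2 * (9 * (1 / (ω - ω ^ 2)) ^ 2), ?_, fun c => ?_⟩
      · have : (9 : K) ≠ 0 := by
          have := mul_ne_zero h3 h3
          norm_num at this ⊢
          exact this
        simp [hs, this]
      have e : x • c = (nu ω).mulVec c := by rw [← hx]; rfl
      rw [e, Matrix.transpose_smul, Matrix.smul_mul, Matrix.smul_mul, Matrix.mul_smul, skew_nu hω,
        smul_smul, smul_smul]
      ring_nf
  | one =>
    refine ⟨1, one_ne_zero, fun c => ?_⟩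
    have : (⟨1, one_mem _⟩ : G32 ω) = 1 := rfl
    rw [this, map_one]
    simp
  | mul x y hx' hy' hx hy =>
    obtain ⟨k, hk, hx⟩ := hx
    obtain ⟨l, hl, hy⟩ := hy
    refine ⟨k * l, mul_ne_zero hk hl, fun c => ?_⟩
    have : (⟨x * y, mul_mem hx' hy'⟩ : G32 ω) = ⟨x, hx'⟩ * ⟨y, hy'⟩ := rfl
    rw [this, map_mul]
    have ex := hx (y • c)
    have ey := hy c
    simp only [Units.val_mul, Matrix.transpose_mul, Subgroup.coe_mul, mul_smul] at ex ey ⊢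
    rw [← ey, ← Matrix.smul_mul, ← Matrix.mul_smul, ← ex]
    simp only [Matrix.mul_assoc]
  | inv x hx' hx =>
    obtain ⟨k, hk, hx⟩ := hx
    refine ⟨k⁻¹, inv_ne_zero hk, fun c => ?_⟩
    have e : (⟨x⁻¹, inv_mem hx'⟩ : G32 ω) = (⟨x, hx'⟩ : G32 ω)⁻¹ := rfl
    have ex := hx (x⁻¹ • c)
    simp only [smul_inv_smul] at ex
    rw [e, map_inv]
    rw [eq_inv_smul_iff₀ hk]
    change k • (_ * skew (x⁻¹ • c) * _) = _
    rw [← Matrix.smul_mul, ← Matrix.mul_smul, ← ex]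
    set R := rho h2 h3 hω ⟨x, hx'⟩
    have e1 : (R : Matrix (Fin 5) (Fin 5) K) * (R⁻¹ : GL (Fin 5) K) = 1 := by
      rw [← Units.val_mul, mul_inv_cancel]; rfl
    have e2 : ((R⁻¹ : GL (Fin 5) K) : Matrix (Fin 5) (Fin 5) K).transpose *
        (R : Matrix (Fin 5) (Fin 5) K).transpose = 1 := by
      rw [← Matrix.transpose_mul, e1, Matrix.transpose_one]
    simp only [Matrix.mul_assoc, e1, Matrix.mul_one]
    rw [← Matrix.mul_assoc, e2, Matrix.one_mul]

theorem incident_smul_iff (g : G32 ω) (c : Fin 4 → K) (q : Fin 5 → K) :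
    Incident ((g : GL (Fin 4) K) • c) (rho h2 h3 hω g • q) ↔ Incident c q := by
  obtain ⟨k, hk, h⟩ := exists_skew_smul h2 h3 hω g
  set R := rho h2 h3 hω g
  have e : (k • skew c).mulVec q =
      (R : Matrix (Fin 5) (Fin 5) K).transpose.mulVec
        ((skew ((g : GL (Fin 4) K) • c)).mulVec (R • q)) := by
    rw [← h c, ← Matrix.mulVec_mulVec, ← Matrix.mulVec_mulVec]
    rfl
  have hR : IsUnit (R : Matrix (Fin 5) (Fin 5) K).transpose :=
    (Matrix.isUnit_transpose _).2 R.isUnit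
  constructor
  · intro h'
    rw [Incident] at h'
    rw [h', Matrix.mulVec_zero, Matrix.smul_mulVec] at e
    exact (smul_eq_zero.1 e).resolve_left hk
  · intro h'
    rw [Incident] at h'
    rw [Matrix.smul_mulVec, h', smul_zero] at e
    exact Matrix.mulVec_injective_of_isUnit hR (e.symm.trans (Matrix.mulVec_zero _).symm)

theorem incident_smul_smul_iff {a b : K} (ha : a ≠ 0) (hb : b ≠ 0) (c : Fin 4 → K)
    (q : Fin 5 → K) : Incident (a • c) (b • q) ↔ Incident c q := by
  simp [Incident, skew_smul, Matrix.smul_mulVec, Matrix.mulVec_smul, ha, hb]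

/-- The quartic form is a semi-invariant of `G₃₂`. -/
theorem exists_quarticForm_smul (g : G32 ω) : ∃ k : K, k ≠ 0 ∧ ∀ q : Fin 5 → K,
    quarticForm (rho h2 h3 hω g • q) = k * quarticForm q := by
  obtain ⟨g, hg⟩ := g
  have hs := sub_ne_zero' h3 hω
  have h0 : ω ≠ 0 := hω.ne_zero (by norm_num)
  have hrel := omega_rel hω
  induction hg using Subgroup.closure_induction with
  | mem x hx =>
    rcases hx with hx | hx
    · generalize_proofs hg
      have e := rho_mu h2 h3 hω hg hx
      refine ⟨(-ω) ^ 4, by simp [h0], fun q => ?_⟩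
      change quarticForm (Matrix.mulVec (rho h2 h3 hω _ : Matrix _ _ K) q) = _
      rw [e, Matrix.smul_mulVec, quarticForm_smul]
      congr 1
      simp [quarticForm, Matrix.mulVec, dotProduct, Fin.sum_univ_succ]
      ring
    · generalize_proofs hg
      have e := rho_nu h2 h3 hω hg hx
      have h9 : (9 : K) ≠ 0 := by
        have := mul_ne_zero h3 h3
        norm_num at this ⊢
        exact this
      refine ⟨(1 / (ω - ω ^ 2)) ^ 4 * 9, by simp [hs, h9], fun q => ?_⟩
      change quarticForm (Matrix.mulVec (rho h2 h3 hω _ : Matrix _ _ K) q) = _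
      rw [e, Matrix.smul_mulVec, quarticForm_smul, mul_assoc]
      congr 1
      simp [quarticForm, Matrix.mulVec, dotProduct, Fin.sum_univ_succ]
      grind
  | one =>
    refine ⟨1, one_ne_zero, fun c => ?_⟩
    have : (⟨1, one_mem _⟩ : G32 ω) = 1 := rfl
    rw [this, map_one]
    simp
  | mul x y hx' hy' hx hy =>
    obtain ⟨k, hk, hx⟩ := hx
    obtain ⟨l, hl, hy⟩ := hy
    refine ⟨k * l, mul_ne_zero hk hl, fun c => ?_⟩
    have : (⟨x * y, mul_mem hx' hy'⟩ : G32 ω) = ⟨x, hx'⟩ * ⟨y, hy'⟩ := rfl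
    rw [this, map_mul, mul_smul, hx, hy, mul_assoc]
  | inv x hx' hx =>
    obtain ⟨k, hk, hx⟩ := hx
    refine ⟨k⁻¹, inv_ne_zero hk, fun c => ?_⟩
    have e : (⟨x⁻¹, inv_mem hx'⟩ : G32 ω) = (⟨x, hx'⟩ : G32 ω)⁻¹ := rfl
    rw [e, map_inv, eq_inv_mul_iff_mul_eq₀ hk, ← hx, smul_inv_smul]

/-- The pairs `(c, q)` and `(c', q')` of vectors in `K⁴ × K⁵` are carried to one another by some
element of `G₃₂`, up to a nonzero scalar in each component. Either component may be zero, which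
leaves a relation between the other two. -/
def Related (c : Fin 4 → K) (q : Fin 5 → K) (c' : Fin 4 → K) (q' : Fin 5 → K) : Prop :=
  ∃ g : G32 ω, ∃ a b : K, a ≠ 0 ∧ b ≠ 0 ∧ (g : GL (Fin 4) K) • c = a • c' ∧
    rho h2 h3 hω g • q = b • q'

section
variable {h2 h3 hω}
variable {c c' c'' : Fin 4 → K} {q q' q'' : Fin 5 → K}

theorem related_smul {a b : K} (ha : a ≠ 0) (hb : b ≠ 0) (c : Fin 4 → K) (q : Fin 5 → K) :
    Related h2 h3 hω (a • c) (b • q) c q :=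
  ⟨1, a, b, ha, hb, by simp, by simp⟩

theorem Related.symm (h : Related h2 h3 hω c q c' q') : Related h2 h3 hω c' q' c q := by
  obtain ⟨g, a, b, ha, hb, hc, hq⟩ := h
  refine ⟨g⁻¹, a⁻¹, b⁻¹, inv_ne_zero ha, inv_ne_zero hb, ?_, ?_⟩
  · rw [Subgroup.coe_inv, inv_smul_eq_iff, smul_comm, hc, inv_smul_smul₀ ha]
  · rw [map_inv, inv_smul_eq_iff, smul_comm, hq, inv_smul_smul₀ hb]

theorem Related.trans (h : Related h2 h3 hω c q c' q') (h' : Related h2 h3 hω c' q' c'' q'') :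
    Related h2 h3 hω c q c'' q'' := by
  obtain ⟨g, a, b, ha, hb, hc, hq⟩ := h
  obtain ⟨g', a', b', ha', hb', hc', hq'⟩ := h'
  refine ⟨g' * g, a * a', b * b', mul_ne_zero ha ha', mul_ne_zero hb hb', ?_, ?_⟩
  · rw [Subgroup.coe_mul, mul_smul, hc, smul_comm, hc', smul_smul]
  · rw [map_mul, mul_smul, hq, smul_comm, hq', smul_smul]

theorem Related.incident_iff (h : Related h2 h3 hω c q c' q') :
    Incident c q ↔ Incident c' q' := by
  obtain ⟨g, a, b, ha, hb, hc, hq⟩ := h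
  rw [← incident_smul_iff h2 h3 hω g, hc, hq, incident_smul_smul_iff ha hb]

theorem Related.quarticForm_eq_zero_iff (h : Related h2 h3 hω c q c' q') :
    quarticForm q = 0 ↔ quarticForm q' = 0 := by
  obtain ⟨g, a, b, ha, hb, hc, hq⟩ := h
  obtain ⟨k, hk, hg⟩ := exists_quarticForm_smul h2 h3 hω g
  have := hg q
  rw [hq, quarticForm_smul] at this
  constructor <;> intro h <;> rw [h] at this <;> simpa [hk, hb] using this

theorem Related.left_eq_zero_iff (h : Related h2 h3 hω c q c' q') : c = 0 ↔ c' = 0 := by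
  obtain ⟨g, a, b, ha, hb, hc, hq⟩ := h
  rw [← smul_eq_zero_iff_eq (g : GL (Fin 4) K), hc, smul_eq_zero_iff_right ha]

theorem Related.right_eq_zero_iff (h : Related h2 h3 hω c q c' q') : q = 0 ↔ q' = 0 := by
  obtain ⟨g, a, b, ha, hb, hc, hq⟩ := h
  rw [← smul_eq_zero_iff_eq (rho h2 h3 hω g), hq, smul_eq_zero_iff_right hb]

end

end

/-! ### Monomial elements of `G₃₂` -/

/-- Some element of `G₃₂` acts on `K⁴` as a nonzero multiple of `f`. Working up to scalars keeps
the monomial elements of the group readable. -/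
def IsSymmetry (ω : K) (f : (Fin 4 → K) → (Fin 4 → K)) : Prop :=
  ∃ g : GL (Fin 4) K, g ∈ G32 ω ∧ ∃ a : K, a ≠ 0 ∧ ∀ c, g • c = a • f c

section
variable {ω : K} {f f' h : (Fin 4 → K) → (Fin 4 → K)}

theorem IsSymmetry.comp (hf : IsSymmetry ω f) (hf' : IsSymmetry ω f') {k : K} (hk : k ≠ 0)
    (e : ∀ c, f (f' c) = k • h c) : IsSymmetry ω h := by
  obtain ⟨g, hg, a, ha, hf⟩ := hf
  obtain ⟨g', hg', a', ha', hf'⟩ := hf'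
  refine ⟨g * g', mul_mem hg hg', a' * a * k, by simp [*], fun c => ?_⟩
  rw [mul_smul, hf', smul_comm, hf, e, smul_smul, smul_smul, mul_assoc]

/-- If `f` and `f'` are symmetries, then so is `f f' f⁻¹`, here given as a map `h` with
`f f' = k • h f` so that no inverse has to be written down. -/
theorem IsSymmetry.conj (hf : IsSymmetry ω f) (hf' : IsSymmetry ω f') {k : K} (hk : k ≠ 0)
    (e : ∀ c, f (f' c) = k • h (f c)) : IsSymmetry ω h := by
  obtain ⟨g, hg, a, ha, hf⟩ := hf
  obtain ⟨g', hg', a', ha', hf'⟩ := hf'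
  have hs : ∀ (b : K) (c), f (b • c) = b • f c := fun b c => by
    have := hf (b • c)
    rw [smul_comm, hf, smul_comm] at this
    exact (smul_right_injective _ ha this).symm
  refine ⟨g * g' * g⁻¹, mul_mem (mul_mem hg hg') (inv_mem hg), a' * k, by simp [*], fun c => ?_⟩
  obtain ⟨d, rfl⟩ : ∃ d, c = f d := ⟨a • g⁻¹ • c, by
    apply smul_right_injective _ ha
    change a • c = a • f _
    rw [← hf, smul_comm, smul_inv_smul]⟩
  have e1 : g⁻¹ • f d = a⁻¹ • d := by
    rw [inv_smul_eq_iff, smul_comm, hf, inv_smul_smul₀ ha]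
  rw [mul_smul, mul_smul, e1, smul_comm _ a⁻¹, hf', smul_comm _ a⁻¹, smul_comm _ a', hf, e,
    smul_comm _ a, inv_smul_smul₀ ha, smul_smul]

theorem isSymmetry_nu (h3 : (3 : K) ≠ 0) (hω : IsPrimitiveRoot ω 3) : IsSymmetry ω fun c =>
    ![c 1 + c 2 + c 3, c 1 + (-ω - 1) * c 2 + ω * c 3, -c 1 - ω * c 2 + (ω + 1) * c 3,
      (-2 * ω - 1) * c 0] := by
  obtain ⟨u, hu⟩ := isUnit_nu h3 hω
  refine ⟨u, Subgroup.subset_closure (Or.inr hu), 1 / (ω - ω ^ 2),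
    one_div_ne_zero (sub_ne_zero' h3 hω), fun c => ?_⟩
  change (u : Matrix (Fin 4) (Fin 4) K).mulVec c = _
  rw [hu, nu, Matrix.smul_mulVec]
  congr 1
  ext i
  fin_cases i <;> simp [Matrix.mulVec, dotProduct, Fin.sum_univ_succ] <;> ring

theorem isSymmetry_swap_two_three (hω : IsPrimitiveRoot ω 3) : IsSymmetry ω fun c =>
    ![c 0, -c 1, -c 3, -c 2] := by
  obtain ⟨u, hu⟩ := isUnit_mu hω
  refine ⟨u, Subgroup.subset_closure (Or.inl hu), -ω, neg_ne_zero.2 (hω.ne_zero (by norm_num)),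
    fun c => ?_⟩
  change (u : Matrix (Fin 4) (Fin 4) K).mulVec c = _
  rw [hu, mu, Matrix.smul_mulVec]
  congr 1
  ext i
  fin_cases i <;> simp [Matrix.mulVec, dotProduct, Fin.sum_univ_succ]

theorem isSymmetry_swap_one_two (h3 : (3 : K) ≠ 0) (hω : IsPrimitiveRoot ω 3) :
    IsSymmetry ω fun c => ![c 0, -c 2, -c 1, -c 3] := by
  have h := omega_rel hω
  refine (isSymmetry_nu h3 hω).conj (isSymmetry_swap_two_three hω) (neg_ne_zero.2 one_ne_zero)
    fun c => ?_
  ext i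
  fin_cases i <;> simp <;> grind

/-- Up to a scalar, the conjugate of `μ` by `ν ^ 2`; this and the conjugates by `ν` and `ν ^ 3`
are monomial. -/
theorem isSymmetry_nu_sq_conj (h3 : (3 : K) ≠ 0) (hω : IsPrimitiveRoot ω 3) :
    IsSymmetry ω fun c => ![-ω * c 0, c 2, ω ^ 2 * c 1, ω * c 3] := by
  have h := omega_rel hω
  refine (isSymmetry_nu h3 hω).conj (isSymmetry_swap_one_two h3 hω) (k := ω ^ 2)
    (by simp [hω.ne_zero]) fun c => ?_
  ext i
  fin_cases i <;> simp <;> grind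

/-- Up to a scalar, the conjugate of `μ` by `ν ^ 3`. -/
theorem isSymmetry_nu_cube_conj (h3 : (3 : K) ≠ 0) (hω : IsPrimitiveRoot ω 3) :
    IsSymmetry ω fun c => ![-ω ^ 2 * c 2, ω * c 1, -c 0, -ω * c 3] := by
  have h := omega_rel hω
  refine (isSymmetry_nu h3 hω).conj (isSymmetry_nu_sq_conj h3 hω) one_ne_zero fun c => ?_
  ext i
  fin_cases i <;> simp <;> grind

theorem isSymmetry_torus (h3 : (3 : K) ≠ 0) (hω : IsPrimitiveRoot ω 3) :
    IsSymmetry ω fun c => ![c 0, ω * c 1, ω ^ 2 * c 2, c 3] := by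
  have h := hω.pow_eq_one
  refine (isSymmetry_swap_one_two h3 hω).comp (isSymmetry_nu_sq_conj h3 hω) (k := -ω)
    (by simp [hω.ne_zero]) fun c => ?_
  ext i
  fin_cases i <;> simp <;> grind

theorem isSymmetry_swap_zero_two (h3 : (3 : K) ≠ 0) (hω : IsPrimitiveRoot ω 3) :
    IsSymmetry ω fun c => ![-c 2, c 1, -c 0, -c 3] := by
  have h := hω.pow_eq_one
  -- The conjugate of `μ` by `ν ^ 3` is the wanted map up to the diagonal symmetry `e'`.
  have e : IsSymmetry ω fun c => ![ω ^ 2 * c 0, ω * c 1, c 2, c 3] := by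
    refine (isSymmetry_nu_cube_conj h3 hω).conj (isSymmetry_torus h3 hω) one_ne_zero fun c => ?_
    ext i
    fin_cases i <;> simp
  have e' : IsSymmetry ω fun c => ![ω ^ 2 * c 0, c 1, ω * c 2, c 3] := by
    refine (e.comp (isSymmetry_torus h3 hω) (h := fun c => ![ω ^ 2 * c 0, ω ^ 2 * c 1,
      ω ^ 2 * c 2, c 3]) one_ne_zero fun c => ?_).comp (isSymmetry_torus h3 hω) one_ne_zero
      fun c => ?_
    all_goals
      ext i
      fin_cases i <;> simp <;> grind
  refine e'.comp (isSymmetry_nu_cube_conj h3 hω) (hω.ne_zero (by norm_num)) fun c => ?_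
  ext i
  fin_cases i <;> simp
  grind
end

section
variable {ω : K} (h2 : (2 : K) ≠ 0) (h3 : (3 : K) ≠ 0) (hω : IsPrimitiveRoot ω 3)

/-- A symmetry acts on the second component through the matrix that describes its effect on `γ`;
this matrix is unique, so it is `ρ` of the group element up to a scalar. -/
theorem IsSymmetry.related {f : (Fin 4 → K) → (Fin 4 → K)} (hf : IsSymmetry ω f)
    (R : Matrix (Fin 5) (Fin 5) K) {b : K} (hb : b ≠ 0)
    (hR : ∀ c, gamma (f c) = b • R.mulVec (gamma c)) (c : Fin 4 → K) (q : Fin 5 → K) :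
    Related h2 h3 hω c q (f c) (R.mulVec q) := by
  obtain ⟨g, hg, a, ha, hf⟩ := hf
  refine ⟨⟨g, hg⟩, a, a ^ 4 * b, ha, mul_ne_zero (pow_ne_zero _ ha) hb, hf c, ?_⟩
  have := rho_eq_of_gamma h2 h3 hω ⟨g, hg⟩ ((a ^ 4 * b) • R) fun c => by
    change gamma (g • c) = _
    rw [hf, gamma_smul, hR, smul_smul, Matrix.smul_mulVec]
  change (rho h2 h3 hω ⟨g, hg⟩ : Matrix (Fin 5) (Fin 5) K).mulVec q = _
  rw [this, Matrix.smul_mulVec]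

theorem related_nu (c : Fin 4 → K) (q : Fin 5 → K) : Related h2 h3 hω c q
    ![c 1 + c 2 + c 3, c 1 + (-ω - 1) * c 2 + ω * c 3, -c 1 - ω * c 2 + (ω + 1) * c 3,
      (-2 * ω - 1) * c 0]
    ![q 0 + q 1, q 2 + q 3 + q 4, q 2 + ω ^ 2 * q 3 + ω * q 4, q 2 + ω * q 3 + ω ^ 2 * q 4,
      2 * q 0 - q 1] := by
  have h := omega_rel hω
  have hs := sub_ne_zero' h3 hω
  have hs2 := sub_sq_mul hω
  have h4 : (ω - ω ^ 2) ^ 3 = -3 * (2 * ω + 1) := by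
    rw [pow_succ, sq, hs2, h]; ring
  convert (isSymmetry_nu h3 hω).related h2 h3 hω
    !![1, 1, 0, 0, 0; 0, 0, 1, 1, 1; 0, 0, 1, ω ^ 2, ω; 0, 0, 1, ω, ω ^ 2; 2, -1, 0, 0, 0]
    (pow_ne_zero 3 hs) (fun c => ?_) c q using 1
  · ext i
    fin_cases i <;> simp [Matrix.mulVec, dotProduct, Fin.sum_univ_succ] <;> ring
  · rw [h4]
    ext i
    fin_cases i <;> simp [gamma] <;> grind

theorem related_swap_two_three (c : Fin 4 → K) (q : Fin 5 → K) : Related h2 h3 hω c q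
    ![c 0, -c 1, -c 3, -c 2] ![q 0, q 1, q 2, q 4, q 3] := by
  convert (isSymmetry_swap_two_three hω).related h2 h3 hω
    !![1, 0, 0, 0, 0; 0, 1, 0, 0, 0; 0, 0, 1, 0, 0; 0, 0, 0, 0, 1; 0, 0, 0, 1, 0]
    (neg_ne_zero.2 one_ne_zero) (fun c => ?_) c q using 1
  · ext i
    fin_cases i <;> simp [Matrix.mulVec, dotProduct, Fin.sum_univ_succ]
  · ext i
    fin_cases i <;> simp [gamma] <;> grind

theorem related_swap_one_two (c : Fin 4 → K) (q : Fin 5 → K) : Related h2 h3 hω c q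
    ![c 0, -c 2, -c 1, -c 3] ![q 0, q 1, q 3, q 2, q 4] := by
  convert (isSymmetry_swap_one_two h3 hω).related h2 h3 hω
    !![1, 0, 0, 0, 0; 0, 1, 0, 0, 0; 0, 0, 0, 1, 0; 0, 0, 1, 0, 0; 0, 0, 0, 0, 1]
    (neg_ne_zero.2 one_ne_zero) (fun c => ?_) c q using 1
  · ext i
    fin_cases i <;> simp [Matrix.mulVec, dotProduct, Fin.sum_univ_succ]
  · ext i
    fin_cases i <;> simp [gamma] <;> grind

theorem related_swap_zero_two (c : Fin 4 → K) (q : Fin 5 → K) : Related h2 h3 hω c q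
    ![-c 2, c 1, -c 0, -c 3] ![q 0, q 3, q 2, q 1, q 4] := by
  convert (isSymmetry_swap_zero_two h3 hω).related h2 h3 hω
    !![1, 0, 0, 0, 0; 0, 0, 0, 1, 0; 0, 0, 1, 0, 0; 0, 1, 0, 0, 0; 0, 0, 0, 0, 1]
    (neg_ne_zero.2 one_ne_zero) (fun c => ?_) c q using 1
  · ext i
    fin_cases i <;> simp [Matrix.mulVec, dotProduct, Fin.sum_univ_succ]
  · ext i
    fin_cases i <;> simp [gamma] <;> grind

theorem related_torus (c : Fin 4 → K) (q : Fin 5 → K) : Related h2 h3 hω c q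
    ![c 0, ω * c 1, ω ^ 2 * c 2, c 3] ![q 0, q 1, ω * q 2, ω ^ 2 * q 3, q 4] := by
  have h := hω.pow_eq_one
  convert (isSymmetry_torus h3 hω).related h2 h3 hω
    !![1, 0, 0, 0, 0; 0, 1, 0, 0, 0; 0, 0, ω, 0, 0; 0, 0, 0, ω ^ 2, 0; 0, 0, 0, 0, 1]
    one_ne_zero (fun c => ?_) c q using 1
  · ext i
    fin_cases i <;> simp [Matrix.mulVec, dotProduct, Fin.sum_univ_succ]
  · ext i
    fin_cases i <;> simp [gamma] <;> grind
end

/-! ### Zeros of a pencil of linear forms on a quadric -/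

section
variable {R : Type*} [CommRing R]
/-- The generalised cross product of three vectors in dimension four: the vector `cross M` with
`r ⬝ᵥ cross M = det (r, M 0, M 1, M 2)` for all `r`. -/
def cross (M : Fin 3 → Fin 4 → R) : Fin 4 → R := fun j =>
  Matrix.det (Matrix.of (Fin.cons (Pi.single j 1) M : Fin 4 → Fin 4 → R))

theorem dotProduct_cross (M : Fin 3 → Fin 4 → R) (r : Fin 4 → R) :
    r ⬝ᵥ cross M = Matrix.det (Matrix.of (Fin.cons r M : Fin 4 → Fin 4 → R)) := by
  have h : ∀ r : Fin 4 → R, Matrix.det (Matrix.of (Fin.cons r M : Fin 4 → Fin 4 → R)) =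
      ∑ j : Fin 4, (-1) ^ (j : ℕ) * r j *
        (Matrix.of fun i k : Fin 3 => M i (j.succAbove k)).det := fun r => by
    rw [Matrix.det_succ_row_zero]
    rfl
  simp only [dotProduct, cross, h, Pi.single_apply, mul_ite, ite_mul, mul_one, mul_zero, zero_mul,
    Finset.sum_ite_eq', Finset.mem_univ, if_true]
  exact Finset.sum_congr rfl fun j _ => by ring

theorem cross_map {S : Type*} [CommRing S] (f : R →+* S) (M : Fin 3 → Fin 4 → R)
    (j : Fin 4) : cross (fun i k => f (M i k)) j = f (cross M j) := by
  rw [cross, cross, RingHom.map_det]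
  congr 1
  ext i k
  refine Fin.cases ?_ (fun i => ?_) i
  · simp [Pi.single_apply, apply_ite f]
  · simp

theorem dotProduct_cross_self (M : Fin 3 → Fin 4 → R) (i : Fin 3) :
    M i ⬝ᵥ cross M = 0 := by
  rw [dotProduct_cross]
  exact Matrix.det_zero_of_row_eq (i := 0) (j := i.succ) (Fin.succ_ne_zero i).symm (by ext; simp)

theorem cross_smul (M : Fin 3 → Fin 4 → R) (a : R) :
    cross (a • M) = a ^ 3 • cross M := by
  ext j
  simp only [cross, Matrix.det_succ_row_zero (n := 3), Pi.smul_apply, smul_eq_mul, Finset.mul_sum]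
  refine Finset.sum_congr rfl fun k _ => ?_
  have : ((Matrix.of (Fin.cons (Pi.single j 1) (a • M) : Fin 4 → Fin 4 → R)).submatrix Fin.succ
      k.succAbove) = a • ((Matrix.of (Fin.cons (Pi.single j 1) M : Fin 4 → Fin 4 → R)).submatrix
      Fin.succ k.succAbove) := by
    ext; simp
  rw [this, Matrix.det_smul]
  simp
  ring
end

theorem not_linearIndependent_of_cross_eq_zero {M : Fin 3 → Fin 4 → K} (h : cross M = 0) :
    ¬ LinearIndependent K M := by
  intro hM
  have hlt : Module.finrank K (Submodule.span K (Set.range M)) < Module.finrank K (Fin 4 → K) := by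
    rw [finrank_span_eq_card hM]
    simp
  obtain ⟨r, -, hr⟩ := SetLike.exists_of_lt (lt_top_iff_ne_top.2 fun e => hlt.ne (by
    rw [e, finrank_top]) : Submodule.span K (Set.range M) < ⊤)
  have hli : LinearIndependent K (Fin.cons r M : Fin 4 → Fin 4 → K) :=
    linearIndependent_finCons.2 ⟨hM, hr⟩
  have := dotProduct_cross M r
  rw [h, dotProduct_zero] at this
  exact ((Matrix.isUnit_iff_isUnit_det _).1 (Matrix.linearIndependent_rows_iff_isUnit.1
    (show LinearIndependent K (Matrix.of (Fin.cons r M : Fin 4 → Fin 4 → K)).row from hli))).ne_zero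
    this.symm

open Polynomial in
/-- A quadric meets every line. -/
theorem exists_quadraticForm_line_eq_zero [IsAlgClosed K] (B : Matrix (Fin 4) (Fin 4) K)
    {v w : Fin 4 → K} (h : LinearIndependent K ![v, w]) :
    ∃ a b : K, a • v + b • w ≠ 0 ∧
      (a • v + b • w) ⬝ᵥ B.mulVec (a • v + b • w) = 0 := by
  have hne := LinearIndependent.pair_iff.1 h
  by_cases hw : w ⬝ᵥ B.mulVec w = 0
  · refine ⟨0, 1, fun h0 => ?_, by simpa using hw⟩
    exact one_ne_zero (hne 0 1 h0).2
  · obtain ⟨b, hb⟩ := IsAlgClosed.exists_root (C (w ⬝ᵥ B.mulVec w) * X ^ 2 +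
      C (v ⬝ᵥ B.mulVec w + w ⬝ᵥ B.mulVec v) * X + C (v ⬝ᵥ B.mulVec v))
      (by rw [degree_quadratic hw]; norm_num)
    refine ⟨1, b, fun h0 => one_ne_zero (hne 1 b h0).1, ?_⟩
    simp [IsRoot] at hb
    simp [Matrix.mulVec_add, Matrix.mulVec_smul]
    linear_combination hb

/-- Three dependent linear forms vanish on a line, which meets the quadric `B`. -/
theorem exists_zero_of_cross_eq_zero [IsAlgClosed K] (B : Matrix (Fin 4) (Fin 4) K)
    {M : Fin 3 → Fin 4 → K} (h : cross M = 0) :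
    ∃ c : Fin 4 → K, c ≠ 0 ∧ c ⬝ᵥ B.mulVec c = 0 ∧ ∀ i, M i ⬝ᵥ c = 0 := by
  have hM := not_linearIndependent_of_cross_eq_zero h
  have hr : (Matrix.of M).rank < 3 := by
    have h1 : (Matrix.of M).rank ≤ 3 := by simpa using Matrix.rank_le_height (Matrix.of M)
    refine lt_of_le_of_ne h1 fun h3 => hM ?_
    rw [Matrix.rank_eq_finrank_span_row] at h3
    rw [linearIndependent_iff_card_eq_finrank_span, Set.finrank, Fintype.card_fin]
    exact h3.symm
  have hk : 1 < Module.finrank K (LinearMap.ker (Matrix.of M).mulVecLin) := by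
    have := LinearMap.finrank_range_add_finrank_ker (Matrix.of M).mulVecLin
    rw [← Matrix.rank] at this
    simp at this
    omega
  obtain ⟨v, hv⟩ := Module.finrank_pos_iff_exists_ne_zero.1 (zero_lt_one.trans hk)
  obtain ⟨w, hw⟩ := exists_linearIndependent_pair_of_one_lt_finrank hk hv
  obtain ⟨a, b, h0, h1⟩ := exists_quadraticForm_line_eq_zero B (v := (v : Fin 4 → K)) (w := w) (by
    rw [LinearIndependent.pair_iff] at hw ⊢
    exact fun s t e => hw s t (Subtype.ext (by simpa using e)))
  refine ⟨_, h0, h1, fun i => ?_⟩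
  exact congrFun (LinearMap.mem_ker.1 (a • v + b • w).2) i

open Polynomial in
theorem exists_polynomial_cross (B : Matrix (Fin 4) (Fin 4) K) (L L' : Fin 3 → Fin 4 → K) :
    ∃ p : K[X], ∀ s : K, p.eval s =
      cross (s • L + L') ⬝ᵥ B.mulVec (cross (s • L + L')) := by
  let M : Fin 3 → Fin 4 → K[X] := fun i k => X * C (L i k) + C (L' i k)
  refine ⟨cross M ⬝ᵥ (B.map C).mulVec (cross M), fun s => ?_⟩
  have h : cross (s • L + L') = fun j => (cross M j).eval s := by
    ext j
    rw [← coe_evalRingHom, ← cross_map]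
    congr 2
    ext i k
    simp [M, mul_comm s]
  rw [h]
  simp [dotProduct, Matrix.mulVec, eval_finsetSum]

/-- Given a quadric in `ℙ³` and a `2 × 3` matrix of linear forms, some point of the quadric is one
where the matrix has rank at most one. The rank condition is that a member `s • L + t • L'` of the
pencil of rows vanishes at the point. When these three forms are independent, their common zero is
their cross product, of degree three in `(s, t)`, and the quadric evaluated there is a binary
sextic, which has a zero. -/
theorem exists_pencil_zero [IsAlgClosed K] (h2 : (2 : K) ≠ 0) (B : Matrix (Fin 4) (Fin 4) K)
    (L L' : Fin 3 → Fin 4 → K) :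
    ∃ c : Fin 4 → K, c ≠ 0 ∧ c ⬝ᵥ B.mulVec c = 0 ∧
      ∃ s t : K, (s ≠ 0 ∨ t ≠ 0) ∧ ∀ i, s * (L i ⬝ᵥ c) + t * (L' i ⬝ᵥ c) = 0 := by
  let F : K → K → K := fun s t => cross (s • L + t • L') ⬝ᵥ B.mulVec (cross (s • L + t • L'))
  have hF : ∀ a s t, F (a * s) (a * t) = a ^ 6 * F s t := fun a s t => by
    simp only [F]
    rw [mul_smul, mul_smul, ← smul_add, cross_smul, Matrix.mulVec_smul, dotProduct_smul,
      smul_dotProduct, smul_smul, smul_eq_mul]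
    ring
  suffices h : ∃ s t, (s ≠ 0 ∨ t ≠ 0) ∧ F s t = 0 by
    obtain ⟨s, t, hst, h⟩ := h
    obtain ⟨c, hc, hB, h0⟩ : ∃ c : Fin 4 → K, c ≠ 0 ∧ c ⬝ᵥ B.mulVec c = 0 ∧
        ∀ i, (s • L + t • L') i ⬝ᵥ c = 0 := by
      by_cases hc : cross (s • L + t • L') = 0
      · exact exists_zero_of_cross_eq_zero B hc
      · exact ⟨_, hc, h, dotProduct_cross_self _⟩
    refine ⟨c, hc, hB, s, t, hst, fun i => ?_⟩
    simpa [add_dotProduct, smul_dotProduct] using h0 i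
  -- If `F` had no zero, its two dehomogenisations would be constant; the sixth power of a scalar
  -- can be `-1`, so homogeneity then forces `F 1 1 = 0`.
  by_contra! hne
  obtain ⟨p, hp⟩ := exists_polynomial_cross B L L'
  obtain ⟨p', hp'⟩ := exists_polynomial_cross B L' L
  have hp : ∀ s, p.eval s = F s 1 := fun s => by simp [hp, F]
  have hp' : ∀ t, p'.eval t = F 1 t := fun t => by simp [hp', F, add_comm]
  have hd : p.degree = 0 := by
    by_contra hd
    obtain ⟨s, hs⟩ := IsAlgClosed.exists_root p hd
    exact hne s 1 (by simp) ((hp s).symm.trans hs)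
  have hd' : p'.degree = 0 := by
    by_contra hd
    obtain ⟨s, hs⟩ := IsAlgClosed.exists_root p' hd
    exact hne 1 s (by simp) ((hp' s).symm.trans hs)
  obtain ⟨t, ht⟩ := IsAlgClosed.exists_pow_nat_eq (-1 : K) (n := 6) (by norm_num)
  have ht0 : t ≠ 0 := by rintro rfl; norm_num at ht
  rw [Polynomial.eq_C_of_degree_eq_zero hd] at hp
  rw [Polynomial.eq_C_of_degree_eq_zero hd'] at hp'
  simp only [Polynomial.eval_C] at hp hp'
  have e1 := hF t t⁻¹ 1
  rw [mul_inv_cancel₀ ht0, mul_one, ht, ← hp', ← hp, hp' 1, hp 1] at e1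
  exact hne 1 1 (by simp) (mul_left_cancel₀ h2 (by linear_combination e1))

/-! ### Points of the quartic are incident to some `c` -/

theorem mul_eq_mul_of_pencil {s t a a' b b' : K} (hst : s ≠ 0 ∨ t ≠ 0)
    (ha : s * a + t * a' = 0) (hb : s * b + t * b' = 0) : a * b' = a' * b := by
  rcases hst with h | h
  · exact mul_left_cancel₀ h (by linear_combination b' * ha - a' * hb)
  · exact mul_left_cancel₀ h (by linear_combination a * hb - b * ha)

/-- At a point of the quartic with `q 0 ≠ 0`, write `Q₁, …, Q₄` for the last four quadrics in `c`
that define incidence; the first one is a combination of them. The numbers `nᵢ` below are the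
partial derivatives of the quartic form at `q`, divided by three. On the quartic the quadrics have
linear syzygies, and when `n₃ ≠ 0` two of these show that the combinations `n₃ Qₖ - nₖ Q₃` are, up
to sign and the factor `(q 0 * n₃)⁻¹`, the minors of a `2 × 3` matrix of linear forms. Hence it
suffices to find a zero of `Q₃` at which that matrix has rank at most one. -/
theorem exists_incident_of_polar_ne_zero [IsAlgClosed K] (h2 : (2 : K) ≠ 0) {q : Fin 5 → K}
    (hq : quarticForm q = 0) (h0 : q 0 ≠ 0) (hn : q 0 * q 3 ^ 2 + q 1 * q 2 * q 4 ≠ 0) :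
    ∃ c : Fin 4 → K, c ≠ 0 ∧ Incident c q := by
  obtain ⟨n1, hn1⟩ : ∃ n, n = q 0 * q 1 ^ 2 + q 2 * q 3 * q 4 := ⟨_, rfl⟩
  obtain ⟨n2, hn2⟩ : ∃ n, n = q 0 * q 2 ^ 2 + q 1 * q 3 * q 4 := ⟨_, rfl⟩
  obtain ⟨n3, hn3⟩ : ∃ n, n = q 0 * q 3 ^ 2 + q 1 * q 2 * q 4 := ⟨_, rfl⟩
  obtain ⟨n4, hn4⟩ : ∃ n, n = q 0 * q 4 ^ 2 + q 1 * q 2 * q 3 := ⟨_, rfl⟩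
  rw [← hn3] at hn
  obtain ⟨c, hc, hB, s, t, hst, h⟩ := exists_pencil_zero h2
    !![0, q 4, 0, -q 2; 0, 0, 0, q 1; 0, 0, q 0, 0; 0, 0, 0, 0]
    ![![0, q 4 * n2, q 4 * n3, -(q 2 * n2 + q 3 * n3)],
      ![q 0 * n3, 0, q 2 ^ 2 * q 4 ^ 2 - q 0 ^ 2 * q 1 * q 3, q 2 * n1],
      ![0, (q 4 ^ 3 + q 0 ^ 3) * q 3, (q 4 ^ 3 + q 0 ^ 3) * q 2, 0]]
    ![![0, q 3 * n3 + q 4 * n4, -(q 2 * n3), -(q 2 * n4)],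
      ![0, 0, -((q 2 ^ 3 + q 0 ^ 3) * q 4), -((q 2 ^ 3 + q 0 ^ 3) * q 3)],
      ![q 0 * n3, -(q 4 * n1), -(q 2 ^ 2 * q 4 ^ 2 - q 0 ^ 2 * q 1 * q 3), 0]]
  have e1 := mul_eq_mul_of_pencil hst (h 0) (h 1)
  have e2 := mul_eq_mul_of_pencil hst (h 0) (h 2)
  have e3 := mul_eq_mul_of_pencil hst (h 1) (h 2)
  simp [dotProduct, Matrix.mulVec, Fin.sum_univ_succ] at hB e1 e2 e3
  rw [quarticForm] at hq
  have hQ3 : q 0 * c 2 ^ 2 + q 1 * c 1 * c 3 - q 2 * c 0 * c 3 + q 4 * c 0 * c 1 = 0 := by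
    linear_combination hB
  have hQ4 : q 0 * c 3 ^ 2 + q 1 * c 1 * c 2 + q 2 * c 0 * c 2 - q 3 * c 0 * c 1 = 0 := by
    apply mul_left_cancel₀ (mul_ne_zero h0 (mul_ne_zero hn hn))
    subst hn1 hn2 hn3 hn4
    linear_combination e1 + q 0 * (q 0 * q 3 ^ 2 + q 1 * q 2 * q 4) *
      (q 0 * q 4 ^ 2 + q 1 * q 2 * q 3) * hQ3 - (q 2 ^ 3 * q 3 * c 3 ^ 2 +
      q 2 ^ 3 * q 4 * c 2 * c 3 - q 2 ^ 2 * q 3 * q 4 * c 1 * c 3 -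
      q 2 ^ 2 * q 4 ^ 2 * c 1 * c 2) * hq
  have hQ2 : q 0 * c 1 ^ 2 + q 1 * c 2 * c 3 + q 3 * c 0 * c 3 - q 4 * c 0 * c 2 = 0 := by
    apply mul_left_cancel₀ (mul_ne_zero h0 (mul_ne_zero hn hn))
    subst hn1 hn2 hn3 hn4
    linear_combination -e2 + q 0 * (q 0 * q 3 ^ 2 + q 1 * q 2 * q 4) *
      (q 0 * q 2 ^ 2 + q 1 * q 3 * q 4) * hQ3 + (q 2 ^ 2 * q 4 ^ 2 * c 2 * c 3 +
      q 2 * q 3 * q 4 ^ 2 * c 1 * c 3 - q 2 * q 4 ^ 3 * c 1 * c 2 - q 3 * q 4 ^ 3 * c 1 ^ 2) * hq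
  have hQ1 : q 0 * c 0 ^ 2 - (q 2 * c 2 * c 3 + q 3 * c 1 * c 3 + q 4 * c 1 * c 2) = 0 := by
    apply mul_left_cancel₀ (mul_ne_zero h0 (mul_ne_zero hn hn))
    subst hn1 hn2 hn3 hn4
    linear_combination e3 + q 0 * (q 0 * q 3 ^ 2 + q 1 * q 2 * q 4) *
      (q 0 * q 1 ^ 2 + q 2 * q 3 * q 4) * hQ3 - (q 0 ^ 2 * q 2 * q 3 * c 2 * c 3 +
      q 0 ^ 2 * q 2 * q 4 * c 2 ^ 2 + q 0 ^ 2 * q 3 ^ 2 * c 1 * c 3 +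
      q 0 ^ 2 * q 3 * q 4 * c 1 * c 2) * hq
  refine ⟨c, hc, (incident_iff c q).2 ⟨mul_left_cancel₀ h0 ?_, ?_, ?_, ?_, ?_⟩⟩
  · linear_combination q 1 * hQ1 + q 2 * hQ2 + q 3 * hQ3 + q 4 * hQ4
  · linear_combination hQ1
  · linear_combination hQ2
  · linear_combination hQ3
  · linear_combination hQ4

/-- When all the partial derivatives in the last four coordinates vanish, an incident point can be
written down. -/
theorem exists_incident_of_node {ω : K} (hω : IsPrimitiveRoot ω 3) {q : Fin 5 → K}
    (hq : quarticForm q = 0) (h0 : q 0 ≠ 0)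
    (h1 : q 0 * q 1 ^ 2 + q 2 * q 3 * q 4 = 0) (h2 : q 0 * q 2 ^ 2 + q 1 * q 3 * q 4 = 0)
    (h3 : q 0 * q 3 ^ 2 + q 1 * q 2 * q 4 = 0) (h4 : q 0 * q 4 ^ 2 + q 1 * q 2 * q 3 = 0) :
    ∃ c : Fin 4 → K, c ≠ 0 ∧ Incident c q := by
  have hr := omega_rel hω
  have h2' : q 2 ≠ 0 := fun h => by
    rw [quarticForm] at hq
    have e1 : q 1 = 0 := by simpa [h, h0] using h1
    have e3 : q 3 = 0 := by simpa [h, h0] using h3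
    have e4 : q 4 = 0 := by simpa [h, h0] using h4
    simp [h, e1, e3, e4, h0] at hq
  refine ⟨![0, q 2, ω * q 3, ω ^ 2 * q 4], fun h => h2' (congrFun h 1), ?_⟩
  rw [incident_iff]
  refine ⟨mul_left_cancel₀ h0 ?_, ?_, ?_, ?_, ?_⟩ <;> simp <;> grind

/-- Every point of the quartic is incident to some `c`. When `q 0 ≠ 0` and some partial derivative
in the last four coordinates is nonzero, a permutation makes that coordinate `q 3`. -/
theorem exists_incident [IsAlgClosed K] (h2 : (2 : K) ≠ 0) (h3 : (3 : K) ≠ 0) {ω : K}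
    (hω : IsPrimitiveRoot ω 3) {q : Fin 5 → K} (hq : quarticForm q = 0) :
    ∃ c : Fin 4 → K, c ≠ 0 ∧ Incident c q := by
  by_cases h0 : q 0 = 0
  · -- The hyperplane `q 0 = 0` meets the quartic in four planes, one for each basis vector `c`.
    have h : q 1 = 0 ∨ q 2 = 0 ∨ q 3 = 0 ∨ q 4 = 0 := by
      simpa [quarticForm, h0, h3, or_assoc] using hq
    rcases h with h | h | h | h
    · exact ⟨![1, 0, 0, 0], by simp, by rw [incident_iff]; simp [h0, h]⟩
    · exact ⟨![0, 1, 0, 0], by simp, by rw [incident_iff]; simp [h0, h]⟩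
    · exact ⟨![0, 0, 1, 0], by simp, by rw [incident_iff]; simp [h0, h]⟩
    · exact ⟨![0, 0, 0, 1], by simp, by rw [incident_iff]; simp [h0, h]⟩
  by_cases n3 : q 0 * q 3 ^ 2 + q 1 * q 2 * q 4 = 0
  swap
  · exact exists_incident_of_polar_ne_zero h2 hq h0 n3
  by_cases n4 : q 0 * q 4 ^ 2 + q 1 * q 2 * q 3 = 0
  swap
  · obtain ⟨c, hc, h⟩ := exists_incident_of_polar_ne_zero h2 (q := ![q 0, q 1, q 2, q 4, q 3])
      (by simp [quarticForm] at hq ⊢; linear_combination hq) h0 n4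
    have hR := related_swap_two_three h2 h3 hω c ![q 0, q 1, q 2, q 4, q 3]
    refine ⟨_, fun h' => hc (hR.left_eq_zero_iff.2 h'), ?_⟩
    convert hR.incident_iff.1 h using 1
    ext i; fin_cases i <;> rfl
  by_cases n2 : q 0 * q 2 ^ 2 + q 1 * q 3 * q 4 = 0
  swap
  · obtain ⟨c, hc, h⟩ := exists_incident_of_polar_ne_zero h2 (q := ![q 0, q 1, q 3, q 2, q 4])
      (by simp [quarticForm] at hq ⊢; linear_combination hq) h0 n2
    have hR := related_swap_one_two h2 h3 hω c ![q 0, q 1, q 3, q 2, q 4]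
    refine ⟨_, fun h' => hc (hR.left_eq_zero_iff.2 h'), ?_⟩
    convert hR.incident_iff.1 h using 1
    ext i; fin_cases i <;> rfl
  by_cases n1 : q 0 * q 1 ^ 2 + q 2 * q 3 * q 4 = 0
  swap
  · obtain ⟨c, hc, h⟩ := exists_incident_of_polar_ne_zero h2 (q := ![q 0, q 3, q 2, q 1, q 4])
      (by simp [quarticForm] at hq ⊢; linear_combination hq) h0
      (by simpa [mul_comm, mul_left_comm] using n1)
    have hR := related_swap_zero_two h2 h3 hω c ![q 0, q 3, q 2, q 1, q 4]
    refine ⟨_, fun h' => hc (hR.left_eq_zero_iff.2 h'), ?_⟩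
    convert hR.incident_iff.1 h using 1
    ext i; fin_cases i <;> rfl
  exact exists_incident_of_node hω hq h0 n1 n2 n3 n4

/-! ### Base points and missed points -/

theorem eq_or_of_cube_eq {ω : K} (hω : IsPrimitiveRoot ω 3) {x y : K} (h : x ^ 3 = y ^ 3) :
    x = y ∨ ω * x = y ∨ ω * (ω * x) = y := by
  have hr := omega_rel hω
  have e : (x - y) * ((ω * x - y) * (ω * (ω * x) - y)) = 0 := by grind
  simpa [sub_eq_zero] using e

/-- Every base point is carried by monomial symmetries and scalars to `![1, 0, 0, 0]` or to
`![0, 1, 1, 1]`. Stated as an induction principle, so that it applies to any property stable under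
these moves. -/
theorem gamma_eq_zero_induction (h3 : (3 : K) ≠ 0) {ω : K} (hω : IsPrimitiveRoot ω 3)
    {P : (Fin 4 → K) → Prop}
    (smul : ∀ (a : K) c, a ≠ 0 → P c → P (a • c))
    (swap_two_three : ∀ c, P ![c 0, -c 1, -c 3, -c 2] → P c)
    (swap_one_two : ∀ c, P ![c 0, -c 2, -c 1, -c 3] → P c)
    (swap_zero_two : ∀ c, P ![-c 2, c 1, -c 0, -c 3] → P c)
    (torus : ∀ c, P ![c 0, ω * c 1, ω ^ 2 * c 2, c 3] → P c)
    (vertex : P ![1, 0, 0, 0]) (ones : P ![0, 1, 1, 1])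
    {c : Fin 4 → K} (hc : c ≠ 0) (h : gamma c = 0) : P c := by
  have torus' : ∀ x y z, P ![0, ω * x, y, z] → P ![0, x, y, z] := fun x y z h =>
    swap_zero_two _ (torus _ (swap_zero_two _ (by simpa using h)))
  have cube : ∀ x y z, x ^ 3 = y ^ 3 → P ![0, y, y, z] → P ![0, x, y, z] := fun x y z hx h => by
    rcases eq_or_of_cube_eq hω hx with e | e | e
    · rwa [e]
    · exact torus' _ _ _ (by rwa [e])
    · exact torus' _ _ _ (torus' _ _ _ (by rwa [e]))
  have e0 : ∀ x, x ≠ 0 → P ![x, 0, 0, 0] := fun x hx => by simpa using smul x _ hx vertex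
  have e2 : ∀ x, x ≠ 0 → P ![0, 0, x, 0] := fun x hx =>
    swap_zero_two _ (by simpa using e0 (-x) (neg_ne_zero.2 hx))
  have e1 : ∀ x, x ≠ 0 → P ![0, x, 0, 0] := fun x hx =>
    swap_one_two _ (by simpa using e2 (-x) (neg_ne_zero.2 hx))
  have e3 : ∀ x, x ≠ 0 → P ![0, 0, 0, x] := fun x hx =>
    swap_two_three _ (by simpa using e2 (-x) (neg_ne_zero.2 hx))
  -- The base points with `c 0 = 0`; the other three coordinate hyperplanes are moved to this one.
  have key : ∀ x y z, ¬ (x = 0 ∧ y = 0 ∧ z = 0) → x * (y ^ 3 - z ^ 3) = 0 →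
      y * (z ^ 3 - x ^ 3) = 0 → z * (x ^ 3 - y ^ 3) = 0 → P ![0, x, y, z] := by
    intro x y z h0 hx hy hz
    by_cases x0 : x = 0
    · subst x0
      by_cases y0 : y = 0
      · subst y0
        exact e3 z (by simpa using h0)
      · have z0 : z = 0 := by simpa [y0] using hy
        subst z0
        exact e2 y y0
    · have hyz : y ^ 3 = z ^ 3 := by simpa [x0, sub_eq_zero] using hx
      by_cases y0 : y = 0
      · subst y0
        have z0 : z = 0 := by simpa using hyz.symm
        subst z0
        exact e1 x x0
      · have hxy : x ^ 3 = y ^ 3 := by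
          have : z ^ 3 = x ^ 3 := by simpa [y0, sub_eq_zero] using hy
          rw [hyz, this]
        refine cube x y z hxy (swap_two_three _ (swap_one_two _ ?_))
        simp only [Matrix.cons_val_zero, Matrix.cons_val_one, Matrix.cons_val, neg_neg]
        exact cube _ _ _ hyz.symm (by simpa using smul y _ y0 ones)
  have hP : ∀ x y z w, ![x, y, z, w] ≠ 0 → gamma ![x, y, z, w] = 0 → P ![x, y, z, w] := by
    intro x y z w h0 h
    have g0 : ((x = 0 ∨ y = 0) ∨ z = 0) ∨ w = 0 := by simpa [gamma, h3] using congrFun h 0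
    have g1 : -(x * (y ^ 3 + z ^ 3 + w ^ 3)) = 0 := by simpa [gamma] using congrFun h 1
    have g2 : y * (x ^ 3 + z ^ 3 - w ^ 3) = 0 := congrFun h 2
    have g3 : z * (x ^ 3 - y ^ 3 + w ^ 3) = 0 := congrFun h 3
    have g4 : w * (x ^ 3 + y ^ 3 - z ^ 3) = 0 := congrFun h 4
    by_cases hx : x = 0
    · subst hx
      exact key _ _ _ (fun h' => h0 (by simp [h'])) (by linear_combination g2)
        (by linear_combination g3) (by linear_combination g4)
    by_cases hz : z = 0
    · subst hz
      refine swap_zero_two _ ?_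
      simp only [Matrix.cons_val_zero, Matrix.cons_val_one, Matrix.cons_val, neg_zero]
      exact key _ _ _ (by simp [hx]) (by linear_combination -g2) (by linear_combination -g1)
        (by linear_combination -g4)
    by_cases hy : y = 0
    · subst hy
      refine swap_one_two _ (swap_zero_two _ ?_)
      simp only [Matrix.cons_val_zero, Matrix.cons_val_one, Matrix.cons_val, neg_zero]
      exact key _ _ _ (by simp [hx]) (by linear_combination g3) (by linear_combination g1)
        (by linear_combination g4)
    have hw : w = 0 := by tauto
    subst hw
    refine swap_two_three _ (swap_zero_two _ ?_)
    simp only [Matrix.cons_val_zero, Matrix.cons_val_one, Matrix.cons_val, neg_zero]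
    exact key _ _ _ (by simp [hx]) (by linear_combination g2) (by linear_combination g1)
      (by linear_combination g3)
  have e : c = ![c 0, c 1, c 2, c 3] := by ext i; fin_cases i <;> rfl
  rw [e] at hc h ⊢
  exact hP _ _ _ _ hc h

/-- The nonzero vector `q` lies on the quartic, and `[q]` is not in the image of `γ`. -/
def IsMissed (q : Fin 5 → K) : Prop :=
  q ≠ 0 ∧ quarticForm q = 0 ∧ ∀ (c : Fin 4 → K) (b : K), b ≠ 0 → gamma c ≠ b • q

/-- A missed point is incident to base points only. -/
theorem IsMissed.gamma_eq_zero {c : Fin 4 → K} {q : Fin 5 → K} (hq : IsMissed q)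
    (h : Incident c q) : gamma c = 0 := by
  by_contra hc
  obtain ⟨a, ha, e⟩ := h.exists_smul hq.1 hc
  exact hq.2.2 c a ha e

section
variable {ω : K} {h2 : (2 : K) ≠ 0} {h3 : (3 : K) ≠ 0} {hω : IsPrimitiveRoot ω 3}

theorem Related.isMissed {c c' : Fin 4 → K} {q q' : Fin 5 → K}
    (h : Related h2 h3 hω c q c' q') (hq : IsMissed q) : IsMissed q' := by
  refine ⟨fun h0 => hq.1 (h.right_eq_zero_iff.2 h0), h.quarticForm_eq_zero_iff.1 hq.2.1,
    fun d t ht hd => ?_⟩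
  obtain ⟨g, a, b, ha, hb, hc, hg⟩ := h.symm
  refine hq.2.2 ((g : GL (Fin 4) K) • d) (t * b) (mul_ne_zero ht hb) ?_
  rw [rho_spec h2 h3 hω, hd, smul_comm, hg, smul_smul]

end

theorem IsMissed.swap_two_three (h2 : (2 : K) ≠ 0) (h3 : (3 : K) ≠ 0) {ω : K}
    (hω : IsPrimitiveRoot ω 3) {a x y z w : K} (h : IsMissed ![a, x, y, z, w]) :
    IsMissed ![a, x, y, w, z] := (related_swap_two_three h2 h3 hω 0 _).isMissed h

theorem IsMissed.swap_one_two (h2 : (2 : K) ≠ 0) (h3 : (3 : K) ≠ 0) {ω : K}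
    (hω : IsPrimitiveRoot ω 3) {a x y z w : K} (h : IsMissed ![a, x, y, z, w]) :
    IsMissed ![a, x, z, y, w] := (related_swap_one_two h2 h3 hω 0 _).isMissed h

theorem IsMissed.swap_zero_two (h2 : (2 : K) ≠ 0) (h3 : (3 : K) ≠ 0) {ω : K}
    (hω : IsPrimitiveRoot ω 3) {a x y z w : K} (h : IsMissed ![a, x, y, z, w]) :
    IsMissed ![a, z, y, x, w] := (related_swap_zero_two h2 h3 hω 0 _).isMissed h

theorem IsMissed.torus (h2 : (2 : K) ≠ 0) (h3 : (3 : K) ≠ 0) {ω : K}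
    (hω : IsPrimitiveRoot ω 3) {a y z w : K} (h : IsMissed ![a, 0, y, z, w]) :
    IsMissed ![a, 0, ω * y, z, w] := by
  have := IsMissed.swap_zero_two h2 h3 hω ((related_torus h2 h3 hω 0 _).isMissed
    (h.swap_zero_two h2 h3 hω))
  simpa using this

/-- The image of `γ` contains every `[0 : 0 : 0 : y : z]` with `y` and `z` nonzero: take
`c = (0, 0, s, t)` with `t ^ 2 = y` and `s ^ 2 = -z`. -/
theorem IsMissed.eq_zero_or_eq_zero [IsAlgClosed K] {y z : K}
    (h : IsMissed ![0, 0, 0, y, z]) :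
    y = 0 ∨ z = 0 := by
  by_contra! hyz
  obtain ⟨t, ht⟩ := IsAlgClosed.exists_pow_nat_eq y (n := 2) (by norm_num)
  obtain ⟨s, hs⟩ := IsAlgClosed.exists_pow_nat_eq (-z) (n := 2) (by norm_num)
  have ht0 : t ≠ 0 := by rintro rfl; exact hyz.1 (by simpa using ht.symm)
  have hs0 : s ≠ 0 := by rintro rfl; exact hyz.2 (by simpa using hs.symm)
  refine h.2.2 ![0, 0, s, t] (s * t) (mul_ne_zero hs0 ht0) ?_
  ext i
  fin_cases i <;> simp [gamma] <;> grind

/-! ### Missed points are special -/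

theorem IsMissed.coordinate [IsAlgClosed K] (h2 : (2 : K) ≠ 0) (h3 : (3 : K) ≠ 0) {ω : K}
    (hω : IsPrimitiveRoot ω 3) {x y z : K} (h : IsMissed ![0, 0, x, y, z])
    (h0 : x = 0 ∨ y = 0 ∨ z = 0) : (x = 0 ∧ y = 0) ∨ (x = 0 ∧ z = 0) ∨ (y = 0 ∧ z = 0) := by
  rcases h0 with rfl | rfl | rfl
  · rcases h.eq_zero_or_eq_zero with rfl | rfl <;> simp
  · rcases (h.swap_one_two h2 h3 hω).eq_zero_or_eq_zero with rfl | rfl <;> simp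
  · rcases ((h.swap_two_three h2 h3 hω).swap_one_two h2 h3 hω).eq_zero_or_eq_zero with
      rfl | rfl <;> simp

theorem IsMissed.torus_of_cube_eq_one (h2 : (2 : K) ≠ 0) (h3 : (3 : K) ≠ 0) {ω : K}
    (hω : IsPrimitiveRoot ω 3) {α x y z : K} (hα : α ^ 3 = 1) (h : IsMissed ![0, 0, x, y, z]) :
    IsMissed ![0, 0, α * x, y, z] := by
  rcases eq_or_of_cube_eq hω (x := 1) (y := α) (by rw [hα, one_pow]) with e | e | e
  · rwa [← e, one_mul]
  · rw [← e, mul_one]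
    exact h.torus h2 h3 hω
  · rw [← e, mul_one, mul_assoc]
    exact (h.torus h2 h3 hω).torus h2 h3 hω

open Polynomial in
/-- For `x, y, z` nonzero, these conditions on `u, v, w` say that `![0, u, v, w]` is incident to
`![0, 0, x, y, z]`. -/
theorem exists_incident_of_plane [IsAlgClosed K] {x y z : K} (hx : x ≠ 0) (hy : y ≠ 0)
    (hz : z ≠ 0) : ∃ u v w : K, u ≠ 0 ∧ v ≠ 0 ∧ w ≠ 0 ∧ x * u ^ 2 + y * v ^ 2 + z * w ^ 2 = 0 ∧
      x * (v * w) + y * (u * w) + z * (u * v) = 0 := by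
  -- Solving the second equation for `u` with `v = s * u` and `w = s` leaves this quartic for `s`.
  have hd : (C (x ^ 2 * y) * X ^ 4 + C (2 * x * y * y) * X ^ 3 + C (y ^ 3 + x ^ 3 + z ^ 3) * X ^ 2 +
    C (2 * x ^ 2 * y) * X + C (x * y ^ 2)).degree = 4 := by
    compute_degree!
  obtain ⟨s, hs⟩ := IsAlgClosed.exists_root _ (by rw [hd]; norm_num)
  simp [IsRoot] at hs
  have hs0 : s ≠ 0 := by
    rintro rfl
    simp [hx, hy] at hs
  have key : (x + y * s ^ 2) * (x * s + y) ^ 2 + z ^ 3 * s ^ 2 = 0 := by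
    linear_combination hs
  have hu : x * s + y ≠ 0 := fun h => by simp [h, hz, hs0] at key
  refine ⟨-(x * s + y) / z, s * (-(x * s + y) / z), s, ?_, ?_, hs0, ?_, ?_⟩
  · exact div_ne_zero (neg_ne_zero.2 hu) hz
  · exact mul_ne_zero hs0 (div_ne_zero (neg_ne_zero.2 hu) hz)
  · field_simp
    linear_combination key
  · field_simp
    ring

theorem IsMissed.of_sum_eq_zero [IsAlgClosed K] (h2 : (2 : K) ≠ 0) (h3 : (3 : K) ≠ 0) {ω : K}
    (hω : IsPrimitiveRoot ω 3) {x y z : K} (h : IsMissed ![0, 0, x, y, z]) (hs : x + y + z = 0) :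
    x ^ 3 = y ^ 3 ∧ y ^ 3 = z ^ 3 := by
  have hr := omega_rel hω
  have h1 : ω - 1 ≠ 0 := sub_ne_zero.2 (hω.ne_one (by norm_num))
  have e := (related_nu h2 h3 hω 0 _).isMissed h
  simp [hs] at e
  have e' := (e.swap_two_three h2 h3 hω).swap_one_two h2 h3 hω
  rcases e'.eq_zero_or_eq_zero with e0 | e0
  · have hz : z = ω ^ 2 * y := mul_left_cancel₀ h1 (by grind)
    have hx : x = ω * y := by grind
    subst hx hz
    grind
  · have hz : z = ω * y := mul_left_cancel₀ h1 (by grind)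
    have hx : x = ω ^ 2 * y := by grind
    subst hx hz
    grind

/-- The missed points in the plane `q 0 = q 1 = 0` of points incident to the vertex
`![1, 0, 0, 0]`: the three coordinate points and the nine points whose coordinates have equal cubes. -/
theorem IsMissed.of_plane [IsAlgClosed K] (h2 : (2 : K) ≠ 0) (h3 : (3 : K) ≠ 0) {ω : K}
    (hω : IsPrimitiveRoot ω 3) {x y z : K} (h : IsMissed ![0, 0, x, y, z]) :
    (x ≠ 0 ∧ x ^ 3 = y ^ 3 ∧ y ^ 3 = z ^ 3) ∨ (x = 0 ∧ y = 0 ∧ z ≠ 0) ∨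
      (x = 0 ∧ z = 0 ∧ y ≠ 0) ∨ (y = 0 ∧ z = 0 ∧ x ≠ 0) := by
  have hne := h.1
  by_cases h0 : x = 0 ∨ y = 0 ∨ z = 0
  · rcases h.coordinate h2 h3 hω h0 with ⟨rfl, rfl⟩ | ⟨rfl, rfl⟩ | ⟨rfl, rfl⟩ <;>
      simpa using hne
  left
  push Not at h0
  obtain ⟨hx, hy, hz⟩ := h0
  refine ⟨hx, ?_⟩
  obtain ⟨u, v, w, hu, hv, hw, e1, e2⟩ := exists_incident_of_plane hx hy hz
  have hg := h.gamma_eq_zero (c := ![0, u, v, w]) (by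
    rw [incident_iff]
    simp
    exact ⟨by linear_combination e1, by linear_combination -e2⟩)
  have g2 : u * (0 ^ 3 + v ^ 3 - w ^ 3) = 0 := congrFun hg 2
  have g4 : w * (0 ^ 3 + u ^ 3 - v ^ 3) = 0 := congrFun hg 4
  have e4 : u ^ 3 = v ^ 3 := by simpa [hw, sub_eq_zero] using g4
  have e5 : v ^ 3 = w ^ 3 := by simpa [hu, sub_eq_zero] using g2
  -- Diagonal symmetries replace `(x, y)` by its product with `((u / w) ^ 2, (v / w) ^ 2)`, which
  -- makes the coordinate sum zero by the incidence equation `e1`.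
  have huv : ((u / w) ^ 2) ^ 3 = 1 := by
    rw [← pow_mul, mul_comm, pow_mul, div_pow, e4, e5, div_self (pow_ne_zero _ hw), one_pow]
  have hvw : ((v / w) ^ 2) ^ 3 = 1 := by
    rw [← pow_mul, mul_comm, pow_mul, div_pow, e5, div_self (pow_ne_zero _ hw), one_pow]
  have h' := ((((h.torus_of_cube_eq_one h2 h3 hω huv).swap_one_two h2 h3 hω).torus_of_cube_eq_one
    h2 h3 hω hvw).swap_one_two h2 h3 hω).of_sum_eq_zero h2 h3 hω (by
      field_simp
      linear_combination e1)
  simpa [mul_pow, huv, hvw] using h'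

/-- The vector `(a, x) ∈ K × K⁴` is, up to a scalar, one of the `160` vectors that represent the
orbit of `[0 : 0 : 0 : 0 : 1]`, with distinguished position `i` among the last four. The
alternatives are, in terms of cube roots of unity `ζ` and with the distinguished coordinate written
last: `(0; 0, 0, 0, 1)`, `(0; ζ₁, ζ₂, ζ₃, 0)`, `(1; 0, 0, 0, -ζ)`, and
`(1; -ζ₁, -ζ₂, -ζ₃, 2 ζ₄)` with `ζ₁ ζ₂ ζ₃ ζ₄ = 1`. -/
def IsSpecialAt (i : Fin 4) (a : K) (x : Fin 4 → K) : Prop :=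
  (a = 0 ∧ x i ≠ 0 ∧ ∀ j ≠ i, x j = 0) ∨
  (a = 0 ∧ x i = 0 ∧ ∃ t ≠ 0, ∀ j ≠ i, x j ^ 3 = t) ∨
  (a ≠ 0 ∧ x i ^ 3 = -a ^ 3 ∧ ∀ j ≠ i, x j = 0) ∨
  (a ≠ 0 ∧ x i ^ 3 = 8 * a ^ 3 ∧ (∀ j ≠ i, x j ^ 3 = -a ^ 3) ∧ ∏ j, x j = -2 * a ^ 4)

/-- Some position is a distinguished one for the coordinates of `q`; see `IsSpecialAt`. -/
def IsSpecial (q : Fin 5 → K) : Prop := ∃ i, IsSpecialAt i (q 0) (Fin.tail q)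

/-- Being special is invariant under permutations of the last four coordinates and under their
scaling by cube roots of unity of product one. -/
theorem IsSpecialAt.of_perm {i : Fin 4} {a : K} {x y : Fin 4 → K} (σ : Equiv.Perm (Fin 4))
    {ζ : Fin 4 → K} (hζ : ∀ j, ζ j ^ 3 = 1) (hp : ∏ j, ζ j = 1)
    (h : ∀ j, x (σ j) = ζ j * y j) (hx : IsSpecialAt (σ i) a x) : IsSpecialAt i a y := by
  have h0 : ∀ j, ζ j ≠ 0 := fun j hj => by simpa [hj] using hζ j
  have hz : ∀ j, x (σ j) = 0 ↔ y j = 0 := fun j => by rw [h]; simp [h0]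
  have hc : ∀ j, x (σ j) ^ 3 = y j ^ 3 := fun j => by rw [h, mul_pow, hζ, one_mul]
  have hpr : ∏ j, x j = ∏ j, y j := by
    rw [← Equiv.prod_comp σ, Finset.prod_congr rfl fun j _ => h j, Finset.prod_mul_distrib, hp,
      one_mul]
  simpa only [IsSpecialAt, ← σ.forall_congr_right (q := fun j => j ≠ σ i → _), ne_eq, hz, hc, hpr,
    σ.injective.eq_iff] using hx

theorem IsSpecial.of_perm {q q' : Fin 5 → K} (σ : Equiv.Perm (Fin 4))
    {ζ : Fin 4 → K} (hζ : ∀ j, ζ j ^ 3 = 1) (hp : ∏ j, ζ j = 1) (h0 : q 0 = q' 0)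
    (h : ∀ j, q (σ j).succ = ζ j * q' j.succ) (hq : IsSpecial q) : IsSpecial q' := by
  obtain ⟨i, hi⟩ := hq
  refine ⟨σ.symm i, ?_⟩
  rw [← h0]
  exact IsSpecialAt.of_perm σ hζ hp h (by simpa using hi)

theorem isSpecial_of_isMissed_of_incident_vertex [IsAlgClosed K] (h2 : (2 : K) ≠ 0)
    (h3 : (3 : K) ≠ 0) {ω : K} (hω : IsPrimitiveRoot ω 3) {q : Fin 5 → K} (h : IsMissed q)
    (hq : Incident ![1, 0, 0, 0] q) : IsSpecial q := by
  obtain ⟨a, x, y, z, w, rfl⟩ : ∃ a x y z w, q = ![a, x, y, z, w] :=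
    ⟨q 0, q 1, q 2, q 3, q 4, by ext i; fin_cases i <;> rfl⟩
  simp [incident_iff] at hq
  obtain ⟨rfl, rfl⟩ := hq
  rcases h.of_plane h2 h3 hω with ⟨h0, h1, h2⟩ | ⟨rfl, rfl, hn⟩ | ⟨rfl, rfl, hn⟩ |
    ⟨rfl, rfl, hn⟩
  · exact ⟨0, Or.inr (Or.inl ⟨rfl, rfl, y ^ 3, pow_ne_zero _ h0, by
      simp [Fin.forall_fin_succ, Fin.tail, h1, h2]⟩)⟩
  · exact ⟨3, Or.inl ⟨rfl, hn, by simp [Fin.forall_fin_succ, Fin.tail]⟩⟩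
  · exact ⟨2, Or.inl ⟨rfl, hn, by simp [Fin.forall_fin_succ, Fin.tail]⟩⟩
  · exact ⟨1, Or.inl ⟨rfl, hn, by simp [Fin.forall_fin_succ, Fin.tail]⟩⟩

/-- Up to a scalar, `ν` carries `![0, 1, 1, 1]` to the vertex `![1, 0, 0, 0]`, so the missed points
incident to the former are found by applying `ν` and using the list `IsMissed.of_plane`. -/
theorem isSpecial_of_isMissed_of_incident_ones [IsAlgClosed K] (h2 : (2 : K) ≠ 0)
    (h3 : (3 : K) ≠ 0) {ω : K} (hω : IsPrimitiveRoot ω 3) {q : Fin 5 → K} (h : IsMissed q)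
    (hq : Incident ![0, 1, 1, 1] q) : IsSpecial q := by
  obtain ⟨a, x, y, z, w, rfl⟩ : ∃ a x y z w, q = ![a, x, y, z, w] :=
    ⟨q 0, q 1, q 2, q 3, q 4, by ext i; fin_cases i <;> rfl⟩
  obtain ⟨hs, -, ha, -, -⟩ := (incident_iff _ _).1 hq
  simp at hs ha
  have hr := omega_rel hω
  have h1 : ω - 1 ≠ 0 := sub_ne_zero.2 (hω.ne_one (by norm_num))
  have hx : x = -a := by linear_combination ha
  clear ha
  subst hx
  have hs' : y = -z - w := by linear_combination hs
  subst hs'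
  have e := (related_nu h2 h3 hω 0 _).isMissed h
  have e' : IsMissed ![0, 0, -z - w + ω ^ 2 * z + ω * w, -z - w + ω * z + ω ^ 2 * w, 3 * a] := by
    convert e using 2
    · simp
    · simp only [Matrix.cons_val_zero, Matrix.cons_val_one, Matrix.cons_val]
      congr 4 <;> ring
  clear e
  have ha0 : (3 : K) * a = 0 → a = 0 := fun h => by simpa [h3] using h
  rcases e'.of_plane h2 h3 hω with ⟨h0, e1, e2⟩ | ⟨e1, e2, e3⟩ | ⟨e1, e2, e3⟩ | ⟨e1, e2, e3⟩
  · have ha : a ≠ 0 := by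
      rintro rfl
      rw [e2] at e1
      exact h0 (by simpa using e1)
    have h27 : (27 : K) ≠ 0 := by
      have := pow_ne_zero 3 h3
      norm_num at this ⊢
      exact this
    obtain ⟨t, ht⟩ : ∃ t, -z - w + ω ^ 2 * z + ω * w = 3 * t := ⟨_, (mul_div_cancel₀ _ h3).symm⟩
    have hta : t ^ 3 = a ^ 3 := mul_left_cancel₀ h27 (by
      rw [ht] at e1
      linear_combination e1 + e2)
    rcases eq_or_of_cube_eq hω e1 with e3 | e3 | e3
    · have hz : z = -t := mul_left_cancel₀ h3 (by grind)
      have hw : w = -t := mul_left_cancel₀ h3 (by grind)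
      subst hz hw
      refine ⟨1, Or.inr (Or.inr (Or.inr ⟨ha, ?_, ?_, ?_⟩))⟩ <;>
        simp [Fin.forall_fin_succ, Fin.tail, Fin.prod_univ_succ] <;> grind
    · have hz : z = -ω ^ 2 * t := mul_left_cancel₀ h3 (by grind)
      have hw : w = 2 * ω ^ 2 * t := mul_left_cancel₀ h3 (by grind)
      subst hz hw
      refine ⟨3, Or.inr (Or.inr (Or.inr ⟨ha, ?_, ?_, ?_⟩))⟩ <;>
        simp [Fin.forall_fin_succ, Fin.tail, Fin.prod_univ_succ] <;> grind
    · have hz : z = 2 * ω * t := mul_left_cancel₀ h3 (by grind)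
      have hw : w = -ω * t := mul_left_cancel₀ h3 (by grind)
      subst hz hw
      refine ⟨2, Or.inr (Or.inr (Or.inr ⟨ha, ?_, ?_, ?_⟩))⟩ <;>
        simp [Fin.forall_fin_succ, Fin.tail, Fin.prod_univ_succ] <;> grind
  · have hz : z = 0 := mul_left_cancel₀ h3 (by grind)
    have hw : w = 0 := mul_left_cancel₀ h3 (by grind)
    subst hz hw
    exact ⟨0, Or.inr (Or.inr (Or.inl ⟨fun h => e3 (by
      have h : a = 0 := h
      simp [h]), by simp [Fin.tail]; ring, by
      simp [Fin.forall_fin_succ, Fin.tail]⟩))⟩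
  · have ha := ha0 e2
    have hw : w = ω ^ 2 * z := mul_left_cancel₀ h1 (by grind)
    subst ha hw
    have hz : z ^ 3 ≠ 0 := fun hz => e3 (by
      have hz : z = 0 := by simpa using hz
      simp [hz])
    refine ⟨0, Or.inr (Or.inl ⟨rfl, by simp [Fin.tail], z ^ 3, hz, ?_⟩)⟩
    simp [Fin.forall_fin_succ, Fin.tail]
    grind
  · have ha := ha0 e2
    have hw : w = ω * z := mul_left_cancel₀ h1 (by grind)
    subst ha hw
    have hz : z ^ 3 ≠ 0 := fun hz => e3 (by
      have hz : z = 0 := by simpa using hz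
      simp [hz])
    refine ⟨0, Or.inr (Or.inl ⟨rfl, by simp [Fin.tail], z ^ 3, hz, ?_⟩)⟩
    simp [Fin.forall_fin_succ, Fin.tail]
    grind

/-- Every missed point is incident to some `c`, necessarily a base point; monomial symmetries move
`c` to one of two base points, and being special is stable under these. -/
theorem IsMissed.isSpecial [IsAlgClosed K] (h2 : (2 : K) ≠ 0) (h3 : (3 : K) ≠ 0) {ω : K}
    (hω : IsPrimitiveRoot ω 3) {q : Fin 5 → K} (h : IsMissed q) : IsSpecial q := by
  obtain ⟨c, hc, hi⟩ := exists_incident h2 h3 hω h.2.1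
  have hg := h.gamma_eq_zero hi
  have h1 := hω.pow_eq_one
  refine gamma_eq_zero_induction h3 hω
    (P := fun c => ∀ q, IsMissed q → Incident c q → IsSpecial q) ?_ ?_ ?_ ?_ ?_
    (fun q h hq => isSpecial_of_isMissed_of_incident_vertex h2 h3 hω h hq)
    (fun q h hq => isSpecial_of_isMissed_of_incident_ones h2 h3 hω h hq) hc hg q h hi
  · intro a c ha h q hq hi
    exact h q hq ((incident_smul_smul_iff ha one_ne_zero c q).1 (by rwa [one_smul]))
  · intro c h q hq hi
    have hR := related_swap_two_three h2 h3 hω c q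
    refine (h _ (hR.isMissed hq) (hR.incident_iff.1 hi)).of_perm (Equiv.swap 2 3)
      (ζ := fun _ => 1) (by simp) (by simp) (by rfl) fun j => ?_
    fin_cases j <;> simp <;> rfl
  · intro c h q hq hi
    have hR := related_swap_one_two h2 h3 hω c q
    refine (h _ (hR.isMissed hq) (hR.incident_iff.1 hi)).of_perm (Equiv.swap 1 2)
      (ζ := fun _ => 1) (by simp) (by simp) (by rfl) fun j => ?_
    fin_cases j <;> simp <;> rfl
  · intro c h q hq hi
    have hR := related_swap_zero_two h2 h3 hω c q
    refine (h _ (hR.isMissed hq) (hR.incident_iff.1 hi)).of_perm (Equiv.swap 0 2)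
      (ζ := fun _ => 1) (by simp) (by simp) (by rfl) fun j => ?_
    fin_cases j <;> simp <;> rfl
  · intro c h q hq hi
    have hR := related_torus h2 h3 hω c q
    refine (h _ (hR.isMissed hq) (hR.incident_iff.1 hi)).of_perm (Equiv.refl _)
      (ζ := ![1, ω, ω ^ 2, 1]) ?_ ?_ (by rfl) fun j => ?_
    · simp [Fin.forall_fin_succ, h1]
      linear_combination (ω ^ 3 + 1) * h1
    · simp [Fin.prod_univ_succ]
      linear_combination h1
    · fin_cases j <;> simp

/-! ### Special points lie in the orbit -/

/-- A property stable under multiplication by `ω` passes between elements with equal cubes. -/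
theorem of_cube_eq {ω : K} (hω : IsPrimitiveRoot ω 3) {P : K → Prop}
    (hP : ∀ x, P x → P (ω * x)) {x y : K} (h : x ^ 3 = y ^ 3) (hx : P x) : P y := by
  rcases eq_or_of_cube_eq hω h with e | e | e
  · rwa [← e]
  · exact e ▸ hP _ hx
  · exact e ▸ hP _ (hP _ hx)

/-- The nonzero multiples of `q` meet the `G₃₂`-orbit of the vector `(0, 0, 0, 0, 1)`. -/
def InOrbit {ω : K} (h2 : (2 : K) ≠ 0) (h3 : (3 : K) ≠ 0) (hω : IsPrimitiveRoot ω 3)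
    (q : Fin 5 → K) : Prop :=
  ∃ g : G32 ω, ∃ b : K, b ≠ 0 ∧ rho h2 h3 hω g • ![0, 0, 0, 0, 1] = b • q

section
variable {ω : K} {h2 : (2 : K) ≠ 0} {h3 : (3 : K) ≠ 0} {hω : IsPrimitiveRoot ω 3}

theorem Related.inOrbit {c c' : Fin 4 → K} {q q' : Fin 5 → K}
    (h : Related h2 h3 hω c q c' q') (hq : InOrbit h2 h3 hω q) : InOrbit h2 h3 hω q' := by
  obtain ⟨g, b, hb, hg⟩ := hq
  obtain ⟨g', a, b', ha, hb', -, hq'⟩ := h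
  exact ⟨g' * g, b * b', mul_ne_zero hb hb', by
    rw [map_mul, mul_smul, hg, smul_comm, hq', smul_smul]⟩

theorem InOrbit.smul {q : Fin 5 → K} (hq : InOrbit h2 h3 hω q) {a : K} (ha : a ≠ 0) :
    InOrbit h2 h3 hω (a • q) :=
  (related_smul one_ne_zero ha 0 q).symm.inOrbit hq

namespace InOrbit
variable {a x y z w : K}

theorem swap_two_three (h : InOrbit h2 h3 hω ![a, x, y, z, w]) :
    InOrbit h2 h3 hω ![a, x, y, w, z] := (related_swap_two_three h2 h3 hω 0 _).inOrbit h

theorem swap_one_two (h : InOrbit h2 h3 hω ![a, x, y, z, w]) :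
    InOrbit h2 h3 hω ![a, x, z, y, w] := (related_swap_one_two h2 h3 hω 0 _).inOrbit h

theorem swap_zero_two (h : InOrbit h2 h3 hω ![a, x, y, z, w]) :
    InOrbit h2 h3 hω ![a, z, y, x, w] := (related_swap_zero_two h2 h3 hω 0 _).inOrbit h

theorem torus_one_two (h : InOrbit h2 h3 hω ![a, x, y, z, w]) :
    InOrbit h2 h3 hω ![a, x, ω * y, ω ^ 2 * z, w] := (related_torus h2 h3 hω 0 _).inOrbit h

theorem torus_one_zero (h : InOrbit h2 h3 hω ![a, x, y, z, w]) :
    InOrbit h2 h3 hω ![a, ω ^ 2 * x, ω * y, z, w] :=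
  h.swap_zero_two.torus_one_two.swap_zero_two

theorem torus_one_three (h : InOrbit h2 h3 hω ![a, x, y, z, w]) :
    InOrbit h2 h3 hω ![a, x, ω * y, z, ω ^ 2 * w] :=
  h.swap_two_three.torus_one_two.swap_two_three

theorem nu (h : InOrbit h2 h3 hω ![a, x, y, z, w]) : InOrbit h2 h3 hω
    ![a + x, y + z + w, y + ω ^ 2 * z + ω * w, y + ω * z + ω ^ 2 * w, 2 * a - x] :=
  (related_nu h2 h3 hω 0 _).inOrbit h

variable (h2 h3 hω) in
theorem last : InOrbit h2 h3 hω ![0, 0, 0, 0, 1] := ⟨1, 1, one_ne_zero, by simp⟩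

variable (h2 h3 hω) in
theorem three_ones : InOrbit h2 h3 hω ![0, 1, 1, 1, 0] := by
  have := (last h2 h3 hω).swap_two_three.swap_one_two.nu
  simpa using this

variable (h2 h3 hω) in
theorem nodal : InOrbit h2 h3 hω ![1, 0, 0, 0, -1] := by
  have := (last h2 h3 hω).swap_two_three.swap_zero_two.nu
  simpa using this

variable (h2 h3 hω) in
theorem general : InOrbit h2 h3 hω ![1, -1, -1, -1, 2] := by
  have hr := omega_rel hω
  have h := (three_ones h2 h3 hω).nu.swap_zero_two.swap_two_three.torus_one_zero.torus_one_zero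
  convert h using 1
  ext i
  fin_cases i <;> simp <;> grind

/-- The orbit contains a representative of each of the four kinds of special vectors (`last`,
`three_ones`, `nodal`, `general`); diagonal symmetries reach the rest. -/
theorem of_isSpecialAt_three (h : IsSpecialAt 3 a ![x, y, z, w]) :
    InOrbit h2 h3 hω ![a, x, y, z, w] := by
  have h1 := hω.pow_eq_one
  rcases h with ⟨rfl, hw, h⟩ | ⟨rfl, hw, t, ht, h⟩ | ⟨ha, hw, h⟩ | ⟨ha, hw, h, hp⟩
  · simp [Fin.forall_fin_succ] at h hw
    obtain ⟨rfl, rfl, rfl⟩ := h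
    simpa using (last h2 h3 hω).smul hw
  · simp [Fin.forall_fin_succ] at h hw
    obtain ⟨hx, hy, hz⟩ := h
    subst hw
    have hz0 : z ≠ 0 := by rintro rfl; exact ht (by simpa using hz.symm)
    have hone : ∀ x y, InOrbit h2 h3 hω ![0, x, y, z, 0] →
        InOrbit h2 h3 hω ![0, x, ω * y, z, 0] := fun x y h => by
      simpa using h.torus_one_three
    have hzero : ∀ x y, InOrbit h2 h3 hω ![0, x, y, z, 0] →
        InOrbit h2 h3 hω ![0, ω * x, y, z, 0] := fun x y h => by
      have h' := h.swap_one_two.swap_zero_two.swap_one_two.torus_one_three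
      simpa using h'.swap_one_two.swap_zero_two.swap_one_two
    refine of_cube_eq hω (P := fun x => InOrbit h2 h3 hω ![0, x, y, z, 0]) (fun x h => hzero x y h)
      (hz.trans hx.symm) ?_
    refine of_cube_eq hω (P := fun y => InOrbit h2 h3 hω ![0, z, y, z, 0]) (fun y h => hone z y h)
      (hz.trans hy.symm) ?_
    simpa using (three_ones h2 h3 hω).smul hz0
  · simp [Fin.forall_fin_succ] at h hw
    obtain ⟨rfl, rfl, rfl⟩ := h
    refine of_cube_eq hω (P := fun w => InOrbit h2 h3 hω ![a, 0, 0, 0, w]) (x := -a) (fun w h => ?_)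
      (by rw [hw]; ring) ?_
    · have := h.torus_one_three.torus_one_three
      have e : ω ^ 2 * (ω ^ 2 * w) = ω * w := by linear_combination ω * w * h1
      simpa [e] using this
    · simpa using (nodal h2 h3 hω).smul ha
  · simp [Fin.forall_fin_succ, Fin.prod_univ_succ] at h hw hp
    obtain ⟨hx, hy, hz⟩ := h
    have e4 : ∀ t : K, ω ^ 2 * (ω ^ 2 * t) = ω * t := fun t => by linear_combination ω * t * h1
    have e3 : ∀ t : K, ω * (ω ^ 2 * t) = t := fun t => by linear_combination t * h1
    -- Diagonal symmetries bring `w` to `2 * a`, then `x` to `-a`, then `y` to `-a`; the condition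
    -- on the product then leaves `z = -a`.
    have hw2 : ∀ w, (∀ x y z, x ^ 3 = -a ^ 3 → y ^ 3 = -a ^ 3 → x * (y * (z * w)) = -(2 * a ^ 4) →
        InOrbit h2 h3 hω ![a, x, y, z, w]) → ∀ x y z, x ^ 3 = -a ^ 3 → y ^ 3 = -a ^ 3 →
        x * (y * (z * (ω ^ 2 * w))) = -(2 * a ^ 4) → InOrbit h2 h3 hω ![a, x, y, z, ω ^ 2 * w] := by
      intro w h x y z hx hy hp
      have := (h x (ω ^ 2 * y) z hx (by grind) (by linear_combination hp)).torus_one_three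
      rwa [e3] at this
    have hx2 : ∀ x, (∀ y z, y ^ 3 = -a ^ 3 → x * (y * (z * (2 * a))) = -(2 * a ^ 4) →
        InOrbit h2 h3 hω ![a, x, y, z, 2 * a]) → ∀ y z, y ^ 3 = -a ^ 3 →
        ω ^ 2 * x * (y * (z * (2 * a))) = -(2 * a ^ 4) →
        InOrbit h2 h3 hω ![a, ω ^ 2 * x, y, z, 2 * a] := by
      intro x h y z hy hp
      have := (h (ω ^ 2 * y) z (by grind) (by linear_combination hp)).torus_one_zero
      rwa [e3] at this
    refine of_cube_eq hω (P := fun w => ∀ x y z, x ^ 3 = -a ^ 3 → y ^ 3 = -a ^ 3 →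
      x * (y * (z * w)) = -(2 * a ^ 4) → InOrbit h2 h3 hω ![a, x, y, z, w]) (x := 2 * a)
      (fun w h => ?_) (by rw [hw]; ring) ?_ x y z hx hy hp
    · have := hw2 _ (hw2 _ h)
      rwa [e4] at this
    clear hx hy hz hp hw
    intro x y z hx hy hp
    refine of_cube_eq hω (P := fun x => ∀ y z, y ^ 3 = -a ^ 3 →
      x * (y * (z * (2 * a))) = -(2 * a ^ 4) → InOrbit h2 h3 hω ![a, x, y, z, 2 * a]) (x := -a)
      (fun x h => ?_) (by rw [hx]; ring) ?_ y z hy hp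
    · have := hx2 _ (hx2 _ h)
      rwa [e4] at this
    clear hx hy hp
    intro y z hy hp
    refine of_cube_eq hω (P := fun y => ∀ z, -a * (y * (z * (2 * a))) = -(2 * a ^ 4) →
      InOrbit h2 h3 hω ![a, -a, y, z, 2 * a]) (x := -a) (fun y h z hp => ?_) (by rw [hy]; ring) ?_
      z hp
    · have := (h (ω * z) (by linear_combination hp)).torus_one_two
      have e3' : ω ^ 2 * (ω * z) = z := by linear_combination z * h1
      rwa [e3'] at this
    intro z hz
    have hz : z = -a := mul_left_cancel₀ (mul_ne_zero h2 (pow_ne_zero 3 ha))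
      (by linear_combination hz)
    subst hz
    simpa [mul_comm] using (general h2 h3 hω).smul ha

theorem of_isSpecial {q : Fin 5 → K} (h : IsSpecial q) : InOrbit h2 h3 hω q := by
  obtain ⟨a, x, y, z, w, rfl⟩ : ∃ a x y z w, q = ![a, x, y, z, w] :=
    ⟨q 0, q 1, q 2, q 3, q 4, by ext i; fin_cases i <;> rfl⟩
  obtain ⟨i, hi⟩ := h
  have key : ∀ (x' y' z' w' : K) (σ : Equiv.Perm (Fin 4)), σ 3 = i →
      (∀ j, ![x, y, z, w] (σ j) = ![x', y', z', w'] j) →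
      InOrbit h2 h3 hω ![a, x', y', z', w'] := fun x' y' z' w' σ h3 h => by
    refine of_isSpecialAt_three (IsSpecialAt.of_perm (x := ![x, y, z, w]) (ζ := fun _ => 1) σ
      (by simp) (by simp) (by simpa using h) ?_)
    rw [h3]
    exact hi
  fin_cases i
  · exact (key z y w x (Equiv.swap 0 2 * Equiv.swap 2 3) (by decide)
      (fun j => by fin_cases j <;> rfl)).swap_two_three.swap_zero_two
  · exact (key x z w y (Equiv.swap 1 2 * Equiv.swap 2 3) (by decide)
      (fun j => by fin_cases j <;> rfl)).swap_two_three.swap_one_two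
  · exact (key x y w z (Equiv.swap 2 3) (by decide)
      (fun j => by fin_cases j <;> rfl)).swap_two_three
  · exact key x y z w 1 (by decide) (fun _ => rfl)

end InOrbit

/-- If the first four entries of `γ(c)` vanish, then so does the last one. -/
theorem isMissed_last (h3 : (3 : K) ≠ 0) : IsMissed (K := K) ![0, 0, 0, 0, 1] := by
  refine ⟨by simp, by simp [quarticForm], fun c b hb h => ?_⟩
  have e0 := congrFun h 0
  have e1 := congrFun h 1
  have e2 := congrFun h 2
  have e3 := congrFun h 3
  have e4 := congrFun h 4
  simp [gamma, h3] at e0 e1 e2 e3 e4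
  have hw : c 3 ≠ 0 := fun h => hb (by rw [← e4, h, zero_mul])
  have hw3 : c 3 ^ 3 ≠ 0 := pow_ne_zero 3 hw
  have h' : c 0 ^ 3 + c 1 ^ 3 - c 2 ^ 3 = 0 := by
    simp only [hw, or_false] at e0
    rcases e0 with (h0 | h0) | h0 <;> rw [h0] at e1 e2 e3 ⊢ <;> simp at e1 e2 e3 ⊢ <;> grind
  rw [h', mul_zero] at e4
  exact hb e4.symm

end

/-! ### Base locus and image -/

section
variable {ω : K} {h2 : (2 : K) ≠ 0} {h3 : (3 : K) ≠ 0} {hω : IsPrimitiveRoot ω 3}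

theorem InOrbit.isMissed {q : Fin 5 → K} (h : InOrbit h2 h3 hω q) : IsMissed q := by
  obtain ⟨g, b, hb, hg⟩ := h
  have hr : Related h2 h3 hω 0 ![0, 0, 0, 0, 1] 0 q := ⟨g, 1, b, one_ne_zero, hb, by simp, hg⟩
  exact hr.isMissed (isMissed_last h3)

theorem inOrbit_iff_isMissed [IsAlgClosed K] {q : Fin 5 → K} :
    InOrbit h2 h3 hω q ↔ IsMissed q :=
  ⟨InOrbit.isMissed, fun h => .of_isSpecial (h.isSpecial h2 h3 hω)⟩

theorem mk_mem_missingOrbit {q : Fin 5 → K} (hq : q ≠ 0) :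
    Projectivization.mk K q hq ∈ missingOrbit h2 h3 hω ↔ InOrbit h2 h3 hω q := by
  rw [missingOrbit, Set.mem_range, InOrbit]
  refine exists_congr fun g => ?_
  rw [lastPoint, Projectivization.smul_mk, Projectivization.mk_eq_mk_iff']
  refine exists_congr fun b => ⟨fun h => ⟨?_, h.symm⟩, fun h => h.2.symm⟩
  rintro rfl
  rw [zero_smul, eq_comm, smul_eq_zero_iff_eq] at h
  simpa using congrFun h 4

theorem missingOrbit_subset_quartic : missingOrbit h2 h3 hω ⊆ quartic K := fun p hp => by
  induction p using Projectivization.ind with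
  | h q hq => exact (mk_mem_quartic hq).2 ((mk_mem_missingOrbit hq).1 hp).isMissed.2.1

theorem baseLocus_eq_family6 (h2 : (2 : K) ≠ 0) (h3 : (3 : K) ≠ 0) (hω : IsPrimitiveRoot ω 3) :
    baseLocus K = family6 ω := by
  have hv : (![1, 0, 0, 0] : Fin 4 → K) ≠ 0 := by simp
  ext p
  induction p using Projectivization.ind with
  | h c hc =>
    rw [mk_mem_baseLocus, family6, MulAction.mem_orbit_iff]
    constructor
    · intro h
      have hz : (![0, 0, 0, 0, 0] : Fin 5 → K) = 0 := by simp
      have key : Related h2 h3 hω c 0 ![1, 0, 0, 0] 0 := by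
        refine gamma_eq_zero_induction (P := fun c => Related h2 h3 hω c 0 ![1, 0, 0, 0] 0) h3 hω
          (fun a c ha h => ?_) (fun c h => ?_) (fun c h => ?_) (fun c h => ?_) (fun c h => ?_)
          ?_ ?_ hc h
        · have := (related_smul (h2 := h2) (h3 := h3) (hω := hω) ha one_ne_zero c 0).trans h
          simpa using this
        · have := related_swap_two_three h2 h3 hω c 0
          exact Related.trans (by simpa [hz] using this) h
        · have := related_swap_one_two h2 h3 hω c 0
          exact Related.trans (by simpa [hz] using this) h
        · have := related_swap_zero_two h2 h3 hω c 0
          exact Related.trans (by simpa [hz] using this) h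
        · have := related_torus h2 h3 hω c 0
          exact Related.trans (by simpa [hz] using this) h
        · simpa using related_smul (h2 := h2) (h3 := h3) (hω := hω) one_ne_zero one_ne_zero
            ![1, 0, 0, 0] 0
        · have h1 := related_nu h2 h3 hω ![0, 1, 1, 1] 0
          have h2' := related_smul (h2 := h2) (h3 := h3) (hω := hω) h3 one_ne_zero
            ![1, 0, 0, 0] 0
          refine Related.trans h1 ?_
          convert h2' using 1
          · ext i
            fin_cases i <;> simp <;> ring
          · ext i
            fin_cases i <;> simp
      obtain ⟨g, a, b, ha, -, hg, -⟩ := key.symm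
      refine ⟨g, ?_⟩
      rw [Subgroup.smul_def, Projectivization.smul_mk, Projectivization.mk_eq_mk_iff']
      exact ⟨a, hg.symm⟩
    · rintro ⟨g, hg⟩
      rw [Subgroup.smul_def, Projectivization.smul_mk, Projectivization.mk_eq_mk_iff'] at hg
      obtain ⟨a, ha⟩ := hg
      have h0 : a ≠ 0 := by
        rintro rfl
        rw [zero_smul, eq_comm, smul_eq_zero_iff_eq] at ha
        exact hv ha
      have := rho_spec h2 h3 hω g ![1, 0, 0, 0]
      have e : gamma (![1, 0, 0, 0] : Fin 4 → K) = 0 := by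
        ext i
        fin_cases i <;> simp [gamma]
      rw [e, smul_zero, ← ha, gamma_smul] at this
      exact (smul_eq_zero.1 this).resolve_left (pow_ne_zero 4 h0)

theorem quarticForm_gamma (c : Fin 4 → K) : quarticForm (gamma c) = 0 := by
  simp [quarticForm, gamma]
  ring

theorem range_gammaMap [IsAlgClosed K] :
    Set.range (gammaMap (K := K)) = quartic K \ missingOrbit h2 h3 hω := by
  ext p
  induction p using Projectivization.ind with
  | h q hq =>
    rw [Set.mem_sdiff, mk_mem_quartic, mk_mem_missingOrbit, inOrbit_iff_isMissed]
    constructor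
    · rintro ⟨⟨p, hp⟩, h⟩
      induction p using Projectivization.ind with
      | h c hc =>
        rw [gammaMap_mk, Projectivization.mk_eq_mk_iff'] at h
        obtain ⟨b, hb⟩ := h
        have h0 : b ≠ 0 := by
          rintro rfl
          rw [zero_smul] at hb
          exact hp ((mk_mem_baseLocus hc).2 hb.symm)
        refine ⟨?_, fun h => h.2.2 c b h0 hb.symm⟩
        have := quarticForm_gamma c
        rw [← hb, quarticForm_smul] at this
        exact (mul_eq_zero.1 this).resolve_left (pow_ne_zero 4 h0)
    · rintro ⟨hF, h⟩
      have h' : ∃ c, ∃ b : K, b ≠ 0 ∧ gamma c = b • q := by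
        by_contra! h'
        exact h ⟨hq, hF, h'⟩
      obtain ⟨c, b, hb, e⟩ := h'
      have hg : gamma c ≠ 0 := by
        rw [e]
        exact smul_ne_zero hb hq
      have hc : c ≠ 0 := by
        rintro rfl
        exact hg (by ext i; fin_cases i <;> simp [gamma])
      refine ⟨⟨Projectivization.mk K c hc, fun h => hg ((mk_mem_baseLocus hc).1 h)⟩, ?_⟩
      rw [gammaMap_mk, Projectivization.mk_eq_mk_iff']
      exact ⟨b, e.symm⟩

end

/-! ### Counting the orbit -/

/-- The kind of a special vector and the exponents of the powers of `ω` it is built from. The four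
summands are the four kinds of special vectors, in the order of `IsSpecialAt`; there are
`1 + 9 + 3 + 27 = 40` shapes. -/
abbrev Shape : Type := Unit ⊕ (Fin 3 × Fin 3) ⊕ Fin 3 ⊕ (Fin 3 × Fin 3 × Fin 3)

/-- The first coordinate of a normalised special vector. -/
def specialLead : Shape → K
  | .inl _ | .inr (.inl _) => 0
  | .inr (.inr _) => 1

/-- The distinguished coordinate of a normalised special vector. In the last kind it is
`2 (ζ₁ ζ₂ ζ₃)⁻¹`, with the inverse written as a square. -/
def specialCoord (ω : K) : Shape → K
  | .inl _ => 1
  | .inr (.inl _) => 0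
  | .inr (.inr (.inl k)) => -ω ^ (k : ℕ)
  | .inr (.inr (.inr (k, l, m))) => 2 * (ω ^ (k + l + m : ℕ)) ^ 2

/-- The three coordinates of a normalised special vector other than the first and the
distinguished one. -/
def specialRest (ω : K) : Shape → Fin 3 → K
  | .inl _ => 0
  | .inr (.inl (k, l)) => ![1, ω ^ (k : ℕ), ω ^ (l : ℕ)]
  | .inr (.inr (.inl _)) => 0
  | .inr (.inr (.inr (k, l, m))) => ![-ω ^ (k : ℕ), -ω ^ (l : ℕ), -ω ^ (m : ℕ)]

/-- The normalised special vector of a given shape, with the given distinguished position. -/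
def specialVector (ω : K) (p : Fin 4 × Shape) : Fin 5 → K :=
  Fin.cons (specialLead p.2)
    (p.1.insertNth (α := fun _ => K) (specialCoord ω p.2) (specialRest ω p.2))

section
variable {ω : K}

theorem exists_pow_of_cube_eq_one (hω : IsPrimitiveRoot ω 3) {x : K} (h : x ^ 3 = 1) :
    ∃ k : Fin 3, ω ^ (k : ℕ) = x := by
  obtain ⟨k, hk, e⟩ := hω.eq_pow_of_pow_eq_one h
  exact ⟨⟨k, hk⟩, e⟩

theorem exists_pow_of_cube_eq (hω : IsPrimitiveRoot ω 3) {x y : K} (hy : y ≠ 0)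
    (h : x ^ 3 = y ^ 3) : ∃ k : Fin 3, x = y * ω ^ (k : ℕ) := by
  obtain ⟨k, hk⟩ := exists_pow_of_cube_eq_one hω (x := x / y) (by
    rw [div_pow, h, div_self (pow_ne_zero 3 hy)])
  exact ⟨k, by rw [hk, mul_div_cancel₀ _ hy]⟩

theorem specialVector_isSpecial (hω : IsPrimitiveRoot ω 3)
    (p : Fin 4 × Shape) : IsSpecial (specialVector ω p) := by
  have h1 := hω.pow_eq_one
  have hc : ∀ n : ℕ, (ω ^ n) ^ 3 = 1 := fun n => by rw [pow_right_comm, h1, one_pow]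
  obtain ⟨i, s⟩ := p
  refine ⟨i, ?_⟩
  rcases s with _ | ⟨k, l⟩ | k | ⟨k, l, m⟩
  · refine .inl ⟨rfl, ?_, Fin.forall_iff_succAbove i |>.2 ⟨by simp, fun j _ => ?_⟩⟩ <;>
      simp [specialVector, specialCoord, specialRest]
  · refine .inr (.inl ⟨rfl, ?_, 1, one_ne_zero,
      Fin.forall_iff_succAbove i |>.2 ⟨by simp, fun j _ => ?_⟩⟩)
    · simp [specialVector, specialCoord]
    · fin_cases j <;> simp [specialVector, specialRest, hc]
  · refine .inr (.inr (.inl ⟨one_ne_zero, ?_,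
      Fin.forall_iff_succAbove i |>.2 ⟨by simp, fun j _ => ?_⟩⟩))
    · simp [specialVector, specialCoord, specialLead, neg_pow, hc,
        Odd.neg_one_pow (n := 3) (by decide)]
    · simp [specialVector, specialRest]
  · refine .inr (.inr (.inr ⟨one_ne_zero, ?_,
      Fin.forall_iff_succAbove i |>.2 ⟨by simp, fun j _ => ?_⟩, ?_⟩))
    · simp [specialVector, specialCoord, specialLead, mul_pow, pow_right_comm _ 2 3, hc]
      norm_num
    · fin_cases j <;> simp [specialVector, specialRest, specialLead, neg_pow, hc,
        Odd.neg_one_pow (n := 3) (by decide)]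
    · have := hc (k + l + m)
      simp [specialVector, specialRest, specialLead, specialCoord, Fin.prod_univ_succAbove _ i,
        Fin.prod_univ_succ]
      linear_combination 2 * this

theorem IsSpecial.exists_specialVector (hω : IsPrimitiveRoot ω 3) {q : Fin 5 → K}
    (h : IsSpecial q) : ∃ p, ∃ r : K, r ≠ 0 ∧ q = r • specialVector ω p := by
  obtain ⟨i, hi⟩ := h
  suffices ∃ s : Shape, ∃ r : K, r ≠ 0 ∧ q 0 = r * specialLead s ∧
      Fin.tail q i = r * specialCoord ω s ∧
      ∀ j, Fin.tail q (i.succAbove j) = r * specialRest ω s j by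
    obtain ⟨s, r, hr, e, ei, ej⟩ := this
    refine ⟨(i, s), r, hr, funext fun j => ?_⟩
    refine Fin.cases ?_ (fun j => ?_) j
    · simpa [specialVector] using e
    · revert j
      refine (Fin.forall_iff_succAbove i).2 ⟨?_, fun j => ?_⟩
      · simpa [specialVector, Fin.tail] using ei
      · simpa [specialVector, Fin.tail] using ej j
  generalize q 0 = a at *
  generalize Fin.tail q = x at *
  have hne := fun j => Fin.succAbove_ne i j
  rcases hi with ⟨ha, hx, h⟩ | ⟨ha, hx, t, ht, h⟩ | ⟨ha, hx, h⟩ | ⟨ha, hx, h, hp⟩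
  · exact ⟨.inl (), x i, hx, by simp [specialLead, ha], by simp [specialCoord],
      fun j => by simp [specialRest, h _ (hne j)]⟩
  · have hc := fun j => h _ (hne j)
    have h0 : x (i.succAbove 0) ≠ 0 := fun h0 => ht (by rw [← hc 0, h0, zero_pow (by norm_num)])
    obtain ⟨k, hk⟩ := exists_pow_of_cube_eq hω h0 ((hc 1).trans (hc 0).symm)
    obtain ⟨l, hl⟩ := exists_pow_of_cube_eq hω h0 ((hc 2).trans (hc 0).symm)
    refine ⟨.inr (.inl (k, l)), _, h0, by simp [specialLead, ha], by simp [specialCoord, hx],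
      fun j => ?_⟩
    fin_cases j
    · simp [specialRest]
    · exact hk
    · exact hl
  · obtain ⟨k, hk⟩ := exists_pow_of_cube_eq hω (neg_ne_zero.2 ha)
      (hx.trans (by ring : -a ^ 3 = (-a) ^ 3))
    exact ⟨.inr (.inr (.inl k)), a, ha, by simp [specialLead], by rw [hk]; simp [specialCoord],
      fun j => by simp [specialRest, h _ (hne j)]⟩
  · have hc := fun j => exists_pow_of_cube_eq hω (neg_ne_zero.2 ha)
      ((h _ (hne j)).trans (by ring : -a ^ 3 = (-a) ^ 3))
    choose k hk using hc
    refine ⟨.inr (.inr (.inr (k 0, k 1, k 2))), a, ha, by simp [specialLead], ?_, fun j => ?_⟩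
    · rw [Fin.prod_univ_succAbove _ i, Fin.prod_univ_three, hk, hk, hk] at hp
      have h0 := hω.ne_zero (by norm_num)
      have h3 : (ω ^ (k 0 + k 1 + k 2 : ℕ)) ^ 3 = 1 := by
        rw [pow_right_comm, hω.pow_eq_one, one_pow]
      simp only [specialCoord]
      rw [pow_add, pow_add] at h3 ⊢
      have ha3 : a ^ 3 ≠ 0 := pow_ne_zero 3 ha
      refine mul_left_cancel₀ ha3 ?_
      generalize ω ^ (k 0 : ℕ) = u at *
      generalize ω ^ (k 1 : ℕ) = v at *
      generalize ω ^ (k 2 : ℕ) = w at *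
      linear_combination (-(u * v * w) ^ 2) * hp - a ^ 3 * x i * h3
    · rw [hk]
      fin_cases j <;> simp [specialRest]

theorem specialVector_ne_zero (h2 : (2 : K) ≠ 0) (h3 : (3 : K) ≠ 0)
    (hω : IsPrimitiveRoot ω 3) (p : Fin 4 × Shape) : specialVector ω p ≠ 0 :=
  (InOrbit.of_isSpecial (h2 := h2) (h3 := h3) (hω := hω) (specialVector_isSpecial hω p)).isMissed.1

theorem eq_of_smul_specialVector_eq (h2 : (2 : K) ≠ 0) (h3 : (3 : K) ≠ 0) (hω : IsPrimitiveRoot ω 3)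
    {p p' : Fin 4 × Shape} {r : K} (h : r • specialVector ω p' = specialVector ω p) : p = p' := by
  have hr : r ≠ 0 := by
    rintro rfl
    exact specialVector_ne_zero h2 h3 hω p (by rw [← h, zero_smul])
  obtain ⟨i, s⟩ := p
  obtain ⟨j, t⟩ := p'
  have hω0 : ω ≠ 0 := hω.ne_zero (by norm_num)
  have e0 : r * specialLead t = specialLead s := congrFun h 0
  have e : ∀ l : Fin 4, r * j.insertNth (α := fun _ => K) (specialCoord ω t) (specialRest ω t) l =
      i.insertNth (α := fun _ => K) (specialCoord ω s) (specialRest ω s) l :=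
    fun l => congrFun h l.succ
  -- A position distinguished in neither vector tells the first kind from the second, and the third
  -- from the fourth; the first coordinate tells these two pairs apart.
  obtain ⟨m, n, hmn⟩ : ∃ m n, r * specialRest ω t m = specialRest ω s n := by
    obtain ⟨l, hi, hj⟩ : ∃ l, l ≠ i ∧ l ≠ j := by
      clear e h
      revert i j
      decide
    obtain ⟨m, hm⟩ := Fin.exists_succAbove_eq hj
    obtain ⟨n, hn⟩ := Fin.exists_succAbove_eq hi
    have := e l
    nth_rw 1 [← hm] at this
    rw [← hn] at this
    exact ⟨m, n, by simpa using this⟩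
  -- The distinguished positions agree as soon as the distinguished coordinate of one vector differs
  -- from all ordinary coordinates of the other.
  have key : (∀ k, r * specialRest ω t k ≠ specialCoord ω s) →
      i = j ∧ ∀ l, r * specialRest ω t l = specialRest ω s l := fun hk => by
    have hij : i = j := by
      by_contra hij
      obtain ⟨k, hk'⟩ := Fin.exists_succAbove_eq hij
      have hi := e i
      rw [Fin.insertNth_apply_same, ← hk', Fin.insertNth_apply_succAbove] at hi
      exact hk k hi
    subst hij
    exact ⟨rfl, fun l => by simpa using e (i.succAbove l)⟩
  have key' : i = j → r * specialCoord ω t = specialCoord ω s := by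
    rintro rfl
    simpa using e i
  have inj : ∀ k l : Fin 3, ω ^ (k : ℕ) = ω ^ (l : ℕ) → k = l := fun k l h =>
    Fin.ext (hω.pow_inj k.2 l.2 h)
  have hc : ∀ n : ℕ, (ω ^ n) ^ 3 = 1 := fun n => by rw [pow_right_comm, hω.pow_eq_one, one_pow]
  have hb : ∀ u : Fin 3 × Fin 3, ∀ k, specialRest ω (.inr (.inl u)) k ≠ 0 := fun u k => by
    fin_cases k <;> simp [specialRest, hω0]
  have hd : ∀ u : Fin 3 × Fin 3 × Fin 3, ∀ k,
      specialRest ω (.inr (.inr (.inr u))) k ^ 3 = -1 := fun u k => by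
    fin_cases k <;> simp [specialRest, neg_pow, hc, Odd.neg_one_pow (n := 3) (by decide)]
  have hd0 : ∀ u : Fin 3 × Fin 3 × Fin 3, ∀ k,
      specialRest ω (.inr (.inr (.inr u))) k ≠ 0 := fun u k h => by simpa [h] using hd u k
  rcases s with _ | u | k | u <;> rcases t with _ | u' | k' | u'
  · obtain ⟨rfl, -⟩ := key (by simp [specialRest, specialCoord])
    rfl
  · exact absurd hmn (mul_ne_zero hr (hb _ _))
  · simp [specialLead, hr] at e0
  · simp [specialLead, hr] at e0
  · exact absurd (hmn.symm.trans (mul_zero r)) (hb _ _)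
  · obtain ⟨rfl, hl⟩ := key fun k => mul_ne_zero hr (hb _ _)
    obtain rfl : r = 1 := by simpa [specialRest] using hl 0
    obtain rfl : u' = u := Prod.ext (inj _ _ (by simpa [specialRest] using hl 1))
      (inj _ _ (by simpa [specialRest] using hl 2))
    rfl
  · simp [specialLead, hr] at e0
  · simp [specialLead, hr] at e0
  · simp [specialLead] at e0
  · simp [specialLead] at e0
  · obtain rfl : r = 1 := by simpa [specialLead] using e0
    obtain ⟨rfl, -⟩ := key (by simp [specialRest, specialCoord, hω0])
    rw [inj k' k (by simpa [specialCoord] using key' rfl)]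
  · exact absurd hmn (mul_ne_zero hr (hd0 _ _))
  · simp [specialLead] at e0
  · simp [specialLead] at e0
  · exact absurd (hmn.symm.trans (mul_zero r)) (hd0 _ _)
  · obtain rfl : r = 1 := by simpa [specialLead] using e0
    obtain ⟨rfl, hl⟩ := key fun k hk => by
      -- The distinguished coordinate has cube `8`, the ordinary ones have cube `-1`.
      have h8 : specialCoord ω (.inr (.inr (.inr u))) ^ 3 = 8 := by
        simp only [specialCoord]
        rw [mul_pow, pow_right_comm, hc]
        norm_num
      rw [← hk, one_mul, hd] at h8
      exact mul_ne_zero h3 h3 (by linear_combination -h8)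
    obtain rfl : u' = u := Prod.ext (inj _ _ (by simpa [specialRest] using hl 0)) (Prod.ext
      (inj _ _ (by simpa [specialRest] using hl 1)) (inj _ _ (by simpa [specialRest] using hl 2)))
    rfl

theorem ncard_missingOrbit [IsAlgClosed K] (h2 : (2 : K) ≠ 0) (h3 : (3 : K) ≠ 0)
    (hω : IsPrimitiveRoot ω 3) :
    (missingOrbit h2 h3 hω).ncard = 160 := by
  have hne := specialVector_ne_zero h2 h3 hω
  have e : missingOrbit h2 h3 hω =
      Set.range fun p => Projectivization.mk K (specialVector ω p) (hne p) := by
    ext P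
    induction P using Projectivization.ind with
    | h q hq =>
      rw [mk_mem_missingOrbit]
      constructor
      · intro h
        obtain ⟨p, r, -, hr⟩ := (h.isMissed.isSpecial h2 h3 hω).exists_specialVector hω
        exact ⟨p, ((Projectivization.mk_eq_mk_iff' K _ _ hq (hne p)).2 ⟨r, hr.symm⟩).symm⟩
      · rintro ⟨p, hp⟩
        have hp' := (mk_mem_missingOrbit (h2 := h2) (h3 := h3) (hω := hω) (hne p)).2
          (.of_isSpecial (specialVector_isSpecial hω p))
        exact (mk_mem_missingOrbit hq).1 (hp ▸ hp')
  rw [e, Set.ncard_range_of_injective, Nat.card_eq_fintype_card]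
  · rfl
  · intro p p' h
    obtain ⟨r, hr⟩ := (Projectivization.mk_eq_mk_iff' K _ _ _ _).1 h
    exact eq_of_smul_specialVector_eq h2 h3 hω hr

end

end Burkhardt

theorem mainTheorem7 {K : Type*} [Field K] [IsAlgClosed K]
    (h2 : (2 : K) ≠ 0) (h3 : (3 : K) ≠ 0) (ω : K) (hω : IsPrimitiveRoot ω 3) :
    Burkhardt.baseLocus K = Burkhardt.family6 ω ∧
      Burkhardt.missingOrbit h2 h3 hω ⊆ Burkhardt.quartic K ∧
      Set.range (Burkhardt.gammaMap (K := K)) =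
        Burkhardt.quartic K \ Burkhardt.missingOrbit h2 h3 hω ∧
      (Burkhardt.missingOrbit h2 h3 hω).ncard = 160 :=
  ⟨Burkhardt.baseLocus_eq_family6 h2 h3 hω, Burkhardt.missingOrbit_subset_quartic,
    Burkhardt.range_gammaMap, Burkhardt.ncard_missingOrbit h2 h3 hω⟩
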